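/- Let $r>0$. For a finite set $Q$ of points in the plane, the circular hull $\alpha_r(Q)$ is the intersection of all closed disks of radius $r$ containing $Q$; it is said to exist if at least one such disk exists. Its vertices are the points of $Q$ on its boundary. For two points $p\ne q$ at distance at most $2r$, a minor arc of $p,q$ is an arc of a circle of radius $r$ joining $p$ and $q$ and subtending an angle of at most $180^\circ$. A vertex $w\neq v$ is the clockwise neighbor of a vertex $v$ if the minor arc running clockwise (around the center of its circle) from $v$ to $w$ is part of the boundary of $\alpha_r(Q)$. Assume throughout that the points under consideration have pairwise distinct $x$-coordinates and are in general position: no point lies on a minor arc of two other points. The model of computation is a real RAM with unit-cost, exact arithmetic operations $+,-,\times,/$ and comparisons on real numbers (no roots, no rounding), and with natural-number registers and arrays used for addresses and counters (copy, increment, decrement, comparison, indirect addressing). The programs and the constants below are fixed: they do not depend on $r$, on the points, or on their number. (1) Insertions. The circular hull of an initially empty set $Q$ of points can be maintained under insertions of points, each of which lies strictly to the right of all points of $Q$, in $O(1)$ amortized time per insertion. That is, there are an initialization program, an insertion program and a constant $C$ such that, given $r$, the initialization takes at most $C$ steps and, for every sequence of such insertions and every $m$, the first $m$ insertions take at most $Cm$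 steps in total; and after each insertion it has been decided whether $\alpha_r(Q)$ exists for the current set $Q$ and, if it does, the memory holds $\alpha_r(Q)$ as a circular doubly linked list of its vertices, without repetition, in which each vertex is linked to its clockwise and its counterclockwise neighbor (a single vertex being linked to itself), together with a pointer to the rightmost vertex. (2) Static construction. There are a program and a constant $C$ such that, given $r$ and an array of $n\ge 1$ points sorted by $x$-coordinate, the program takes at most $Cn$ steps, decides whether the circular hull of radius $r$ of these points exists and, if it does, computes it, in the representation described in (1). -/

import Mathlib

/-! ## Circular hulls in the plane -/

namespace CircularHull

abbrev Plane : Type := EuclideanSpace ℝ (Fin 2)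

/-- A disk of radius `r` containing `Q` exists, i.e. the circular hull of `Q` of radius `r` exists. -/
def HullExists (r : ℝ) (Q : Set Plane) : Prop :=
  ∃ c : Plane, Q ⊆ Metric.closedBall c r

/-- The circular hull of radius `r` of `Q`: the intersection of all disks of radius `r`
containing `Q` (meaningful when `HullExists r Q`). -/
def hull (r : ℝ) (Q : Set Plane) : Set Plane :=
  ⋂ c ∈ {c : Plane | Q ⊆ Metric.closedBall c r}, Metric.closedBall c r

/-- The two-dimensional cross product; it is positive when `v` is counterclockwise from `u`. -/
def cross (u v : Plane) : ℝ := u 0 * v 1 - u 1 * v 0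

/-- For `p ≠ q`: the closed minor arc (at most 180 degrees) of radius `r` that runs from `p` to `q`
clockwise around the center `c` of its supporting circle. Along such an arc the center is weakly
to the right of the directed line from `p` to `q`, and the points of the arc are those points of
the circle that are weakly to the left of this line. The other minor arc of `p`, `q` is
`cwArc r q p`. The set is empty when `dist p q > 2 * r`. -/
def cwArc (r : ℝ) (p q : Plane) : Set Plane :=
  {t | ∃ c : Plane, dist p c = r ∧ dist q c = r ∧ cross (q - p) (c - p) ≤ 0 ∧
    dist t c = r ∧ 0 ≤ cross (q - p) (t - p)}

/-- No point of `Q` is on a minor arc of radius `r` of two other points of `Q`. -/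
def GeneralPosition (r : ℝ) (Q : Set Plane) : Prop :=
  ∀ p ∈ Q, ∀ q ∈ Q, ∀ t ∈ Q, p ≠ q → t ≠ p → t ≠ q → t ∉ cwArc r p q

/-- The vertices of the circular hull: the points of `Q` on its boundary. (In general position
no point of `Q` lies in the relative interior of a boundary arc.) -/
def vertices (r : ℝ) (Q : Set Plane) : Set Plane :=
  Q ∩ frontier (hull r Q)

/-- `w` is the clockwise neighbor of `v` on the circular hull of `Q`: the two are distinct vertices,
and the clockwise minor arc from `v` to `w` is part of the boundary of the hull. -/
def IsClockwiseNeighbor (r : ℝ) (Q : Set Plane) (v w : Plane) : Prop :=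
  v ∈ vertices r Q ∧ w ∈ vertices r Q ∧ v ≠ w ∧ cwArc r v w ⊆ frontier (hull r Q)

end CircularHull

/-! ## A real RAM

Programs are finite terms, fixed once and for all, of a structured imperative language over the
memory of a real RAM. Real numbers can be added, subtracted, multiplied, divided and compared, at
unit cost and exactly; there is neither rounding nor conversion of a real number to an integer,
and no root extraction. Natural numbers serve as addresses and counters; they can be copied,
incremented, decremented and compared. Both sorts of numbers are kept in registers and in arrays
with indirect addressing. -/

namespace RealRAM

/-- Memory: registers and arrays for natural numbers and for real numbers. A program, being
finite, mentions only finitely many registers and finitely many arrays. -/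
structure State where
  nreg : ℕ → ℕ
  rreg : ℕ → ℝ
  narr : ℕ → ℕ → ℕ
  rarr : ℕ → ℕ → ℝ

/-- Write `k` into entry `j` of the array `a` of natural numbers. -/
def State.writeNat (σ : State) (a j k : ℕ) : State :=
  { σ with narr := Function.update σ.narr a (Function.update (σ.narr a) j k) }

/-- Write `x` into entry `j` of the array `a` of real numbers. -/
noncomputable def State.writeReal (σ : State) (a j : ℕ) (x : ℝ) : State :=
  { σ with rarr := Function.update σ.rarr a (Function.update (σ.rarr a) j x) }

/-- Expressions for natural numbers. -/
inductive NExpr : Type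
  | const (k : ℕ)
  | reg (i : ℕ)
  | load (a : ℕ) (idx : NExpr)
  | succ (e : NExpr)
  | pred (e : NExpr)

/-- Expressions for real numbers; the only constants are rational. -/
inductive RExpr : Type
  | const (q : ℚ)
  | reg (i : ℕ)
  | load (a : ℕ) (idx : NExpr)
  | add (e f : RExpr)
  | sub (e f : RExpr)
  | mul (e f : RExpr)
  | div (e f : RExpr)

/-- Tests. -/
inductive BExpr : Type
  | natEq (e f : NExpr)
  | natLt (e f : NExpr)
  | realEq (e f : RExpr)
  | realLt (e f : RExpr)
  | not (b : BExpr)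
  | and (b c : BExpr)
  | or (b c : BExpr)

/-- Programs. -/
inductive Cmd : Type
  | skip
  | setNat (i : ℕ) (e : NExpr)
  | setReal (i : ℕ) (e : RExpr)
  | storeNat (a : ℕ) (idx : NExpr) (e : NExpr)
  | storeReal (a : ℕ) (idx : NExpr) (e : RExpr)
  | seq (P P' : Cmd)
  | ite (b : BExpr) (P P' : Cmd)
  | loop (b : BExpr) (P : Cmd)

namespace NExpr

def eval (σ : State) : NExpr → ℕ
  | const k => k
  | reg i => σ.nreg i
  | load a idx => σ.narr a (idx.eval σ)
  | succ e => e.eval σ + 1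
  | pred e => e.eval σ - 1

/-- The number of elementary operations of an evaluation. -/
def cost : NExpr → ℕ
  | const _ => 1
  | reg _ => 1
  | load _ idx => idx.cost + 1
  | succ e => e.cost + 1
  | pred e => e.cost + 1

end NExpr

namespace RExpr

noncomputable def eval (σ : State) : RExpr → ℝ
  | const q => (q : ℝ)
  | reg i => σ.rreg i
  | load a idx => σ.rarr a (idx.eval σ)
  | add e f => e.eval σ + f.eval σ
  | sub e f => e.eval σ - f.eval σ
  | mul e f => e.eval σ * f.eval σ
  | div e f => e.eval σ / f.eval σ

/-- The number of elementary operations of an evaluation. -/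
def cost : RExpr → ℕ
  | const _ => 1
  | reg _ => 1
  | load _ idx => idx.cost + 1
  | add e f => e.cost + f.cost + 1
  | sub e f => e.cost + f.cost + 1
  | mul e f => e.cost + f.cost + 1
  | div e f => e.cost + f.cost + 1

end RExpr

namespace BExpr

def holds (σ : State) : BExpr → Prop
  | natEq e f => e.eval σ = f.eval σ
  | natLt e f => e.eval σ < f.eval σ
  | realEq e f => e.eval σ = f.eval σ
  | realLt e f => e.eval σ < f.eval σ
  | not b => ¬ b.holds σ
  | and b c => b.holds σ ∧ c.holds σ
  | or b c => b.holds σ ∨ c.holds σ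

/-- The number of elementary operations of an evaluation. -/
def cost : BExpr → ℕ
  | natEq e f => e.cost + f.cost + 1
  | natLt e f => e.cost + f.cost + 1
  | realEq e f => e.cost + f.cost + 1
  | realLt e f => e.cost + f.cost + 1
  | not b => b.cost + 1
  | and b c => b.cost + c.cost + 1
  | or b c => b.cost + c.cost + 1

end BExpr

/-- `Exec P σ t σ'`: started in the memory `σ`, the program `P` halts after `t` steps with the
memory `σ'`. -/
inductive Exec : Cmd → State → ℕ → State → Prop
  | skip (σ : State) : Exec Cmd.skip σ 1 σ
  | setNat (σ : State) (i : ℕ) (e : NExpr) :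
      Exec (Cmd.setNat i e) σ (e.cost + 1)
        { σ with nreg := Function.update σ.nreg i (e.eval σ) }
  | setReal (σ : State) (i : ℕ) (e : RExpr) :
      Exec (Cmd.setReal i e) σ (e.cost + 1)
        { σ with rreg := Function.update σ.rreg i (e.eval σ) }
  | storeNat (σ : State) (a : ℕ) (idx e : NExpr) :
      Exec (Cmd.storeNat a idx e) σ (idx.cost + e.cost + 1)
        (σ.writeNat a (idx.eval σ) (e.eval σ))
  | storeReal (σ : State) (a : ℕ) (idx : NExpr) (e : RExpr) :
      Exec (Cmd.storeReal a idx e) σ (idx.cost + e.cost + 1)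
        (σ.writeReal a (idx.eval σ) (e.eval σ))
  | seq {P P' : Cmd} {σ σ' σ'' : State} {t t' : ℕ} (h : Exec P σ t σ') (h' : Exec P' σ' t' σ'') :
      Exec (Cmd.seq P P') σ (t + t') σ''
  | iteTrue {b : BExpr} {P P' : Cmd} {σ σ' : State} {t : ℕ} (hb : b.holds σ) (h : Exec P σ t σ') :
      Exec (Cmd.ite b P P') σ (b.cost + 1 + t) σ'
  | iteFalse {b : BExpr} {P P' : Cmd} {σ σ' : State} {t : ℕ} (hb : ¬ b.holds σ)
      (h : Exec P' σ t σ') :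
      Exec (Cmd.ite b P P') σ (b.cost + 1 + t) σ'
  | loopTrue {b : BExpr} {P : Cmd} {σ σ' σ'' : State} {t t' : ℕ} (hb : b.holds σ)
      (h : Exec P σ t σ') (h' : Exec (Cmd.loop b P) σ' t' σ'') :
      Exec (Cmd.loop b P) σ (b.cost + 1 + t + t') σ''
  | loopFalse {b : BExpr} {P : Cmd} {σ : State} (hb : ¬ b.holds σ) :
      Exec (Cmd.loop b P) σ (b.cost + 1) σ

/-- The machine is deterministic. -/
theorem Exec.deterministic {P : Cmd} {σ σ₁ σ₂ : State} {t₁ t₂ : ℕ}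
    (h₁ : Exec P σ t₁ σ₁) (h₂ : Exec P σ t₂ σ₂) : t₁ = t₂ ∧ σ₁ = σ₂ := by
  induction h₁ generalizing t₂ σ₂ with
  | skip => cases h₂; exact ⟨rfl, rfl⟩
  | setNat => cases h₂; exact ⟨rfl, rfl⟩
  | setReal => cases h₂; exact ⟨rfl, rfl⟩
  | storeNat => cases h₂; exact ⟨rfl, rfl⟩
  | storeReal => cases h₂; exact ⟨rfl, rfl⟩
  | seq _ _ ih ih' =>
    cases h₂ with
    | seq g g' =>
      obtain ⟨rfl, rfl⟩ := ih g
      obtain ⟨rfl, rfl⟩ := ih' g'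
      exact ⟨rfl, rfl⟩
  | iteTrue hb _ ih =>
    cases h₂ with
    | iteTrue _ g => obtain ⟨rfl, rfl⟩ := ih g; exact ⟨rfl, rfl⟩
    | iteFalse hb' _ => exact absurd hb hb'
  | iteFalse hb _ ih =>
    cases h₂ with
    | iteTrue hb' _ => exact absurd hb' hb
    | iteFalse _ g => obtain ⟨rfl, rfl⟩ := ih g; exact ⟨rfl, rfl⟩
  | loopTrue hb _ _ ih ih' =>
    cases h₂ with
    | loopTrue _ g g' =>
      obtain ⟨rfl, rfl⟩ := ih g
      obtain ⟨rfl, rfl⟩ := ih' g'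
      exact ⟨rfl, rfl⟩
    | loopFalse hb' => exact absurd hb hb'
  | loopFalse hb =>
    cases h₂ with
    | loopTrue hb' _ _ => exact absurd hb' hb
    | loopFalse _ => exact ⟨rfl, rfl⟩

end RealRAM

/-! ## Computing and maintaining circular hulls on the real RAM -/

namespace CircularHull

open RealRAM

/-- The point stored in the node with address `a`: its coordinates are in the real arrays
`0` and `1`. -/
noncomputable def nodePoint (σ : State) (a : ℕ) : Plane := !₂[σ.rarr 0 a, σ.rarr 1 a]

/-- The memory holds the circular hull of `Q` as a circular doubly linked list of its `k + 1`
vertices, without repetition. Array `0` holds the pointers to the clockwise neighbors and array `1`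
those to the counterclockwise neighbors; register `0` points to the rightmost vertex. The index
`i + 1` in `Fin (k + 1)` is cyclic; a hull with a single vertex (`k = 0`) has no arcs, and its node
is linked to itself. -/
def StoresHull (r : ℝ) (Q : Set Plane) (σ : State) : Prop :=
  ∃ (k : ℕ) (node : Fin (k + 1) → ℕ),
    Function.Injective (fun i => nodePoint σ (node i)) ∧
    Set.range (fun i => nodePoint σ (node i)) = vertices r Q ∧
    σ.nreg 0 = node 0 ∧
    (∀ i, nodePoint σ (node i) 0 ≤ nodePoint σ (node 0) 0) ∧
    ∀ i, σ.narr 0 (node i) = node (i + 1) ∧ σ.narr 1 (node (i + 1)) = node i ∧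
      (k ≠ 0 → IsClockwiseNeighbor r Q (nodePoint σ (node i)) (nodePoint σ (node (i + 1))))

/-- The answer for `Q`: register `1` tells whether the circular hull exists (`1`) or not (`0`),
and if it exists, the memory holds it. -/
def Answers (r : ℝ) (Q : Set Plane) (σ : State) : Prop :=
  (HullExists r Q ∧ σ.nreg 1 = 1 ∧ StoresHull r Q σ) ∨ (¬ HullExists r Q ∧ σ.nreg 1 = 0)

/-- The memory `σ` after the coordinates of `p` have been written into the real registers
`1` and `2`. -/
noncomputable def withPoint (σ : State) (p : Plane) : State :=
  { σ with rreg := Function.update (Function.update σ.rreg 1 (p 0)) 2 (p 1) }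

/-- `p 0, p 1, …` are sorted strictly from left to right and in general position. -/
def Admissible (r : ℝ) {n : ℕ} (p : Fin n → Plane) : Prop :=
  (∀ i j, i < j → p i 0 < p j 0) ∧ GeneralPosition r (Set.range p)

/-- The programs `init` and `insert` maintain the circular hull under insertions of points to the
right of all current points. The radius `r` is given to `init` in the real register `0`, and
each new point is given to `insert` in the real registers `1` and `2`; otherwise `insert` starts in
the memory left by the previous call, and the memory before `init` is arbitrary. After each
insertion the answer for the current set of points is available. Here `init` takes at most `C`
steps and any `m` first insertions together take at most `C * m` steps. -/
def MaintainsHull (init insert : Cmd) (C : ℕ) : Prop :=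
  ∀ (r : ℝ), 0 < r → ∀ (n : ℕ) (p : Fin n → Plane), Admissible r p →
    ∀ σ₀ : State, σ₀.rreg 0 = r →
      ∃ (σ : ℕ → State) (t₀ : ℕ) (t : ℕ → ℕ),
        Exec init σ₀ t₀ (σ 0) ∧ t₀ ≤ C ∧
        (∀ i : Fin n, Exec insert (withPoint (σ i) (p i)) (t i) (σ ((i : ℕ) + 1)) ∧
          Answers r (p '' Set.Iic i) (σ ((i : ℕ) + 1))) ∧
        ∀ m ≤ n, ∑ i ∈ Finset.range m, t i ≤ C * m

/-- Given the radius `r` in the real register `0`, the number `n ≥ 1` of points in the register `2`,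
and the coordinates of the points, sorted by `x`-coordinate, in the entries `0, …, n - 1` of
the real arrays `0` and `1`, the program `P` halts with the answer for the set of these points after
at most `C * n` steps. -/
def ComputesHullOfSorted (P : Cmd) (C : ℕ) : Prop :=
  ∀ (r : ℝ), 0 < r → ∀ (n : ℕ), 1 ≤ n → ∀ p : Fin n → Plane, Admissible r p →
    ∀ σ₀ : State, σ₀.rreg 0 = r → σ₀.nreg 2 = n →
      (∀ i : Fin n, σ₀.rarr 0 i = p i 0 ∧ σ₀.rarr 1 i = p i 1) →
      ∃ (σ : State) (t : ℕ), Exec P σ₀ t σ ∧ t ≤ C * n ∧ Answers r (Set.range p) σ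

end CircularHull

namespace CircularHull

/-! ### Vectors in the plane -/

/-! A point of `Q` is a vertex exactly when it lies on the circle of some disk of radius `r`
containing `Q` (`mem_vertices_iff`), and a hull edge is witnessed by an `Arc`: two points of `Q` on
the circle of such a disk, joined clockwise by a minor arc. An old arc survives the insertion of `p`
iff its disk contains `p`.

The geometry rests on turning a disk about a vertex `v`. The disks of radius `r` through `v` are
indexed by the directions of their centers, and such a disk contains the intersection of any two
between which its center lies (`cap_between`). If an arc at `v` is lost but `v` survives, then
turning from the center of the lost arc to a center witnessing the survival of `v` meets a circle
through `p`. Hence `p` becomes a neighbor of `v` (`Arc.insert_left`, `Arc.insert_right`). In general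
position `p` has only one clockwise neighbor (`Arc.unique`), so on the cycle there is at most one
passage from a lost arc to a surviving one: the surviving arcs are consecutive, and the new hull is
that run closed up through `p` (`HullCycle.insert_of_found`).

Three cases remain. If both arcs at the rightmost vertex survive, the order of the `x`-coordinates
forbids `p` to be a vertex, and then no center is lost and nothing changes. If no arc survives, at
most one old vertex does; it is detected by a root-free test (`InLens`) and forms a hull of two
vertices with `p`. If that test fails everywhere, no disk exists, because whenever one exists some
old vertex survives (`exists_vertex_insert`); nonexistence is then permanent.

The program searches from the rightmost vertex in both directions for surviving arcs. The rounds
beyond a constant number are paid for by deleted vertices, so a potential proportional to the number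
of vertices gives constant amortized time. The static program inserts the sorted points one by one.
-/

/-- The inner product in coordinates. -/
def dot (u v : Plane) : ℝ := u 0 * v 0 + u 1 * v 1

/-- The reflection in the horizontal axis. -/
noncomputable def mirror (u : Plane) : Plane := !₂[u 0, -u 1]

@[simp] lemma mirror_zero_apply (u : Plane) : mirror u 0 = u 0 := by simp [mirror]
@[simp] lemma mirror_one_apply (u : Plane) : mirror u 1 = -u 1 := by simp [mirror]

lemma dot_mirror (u v : Plane) : dot (mirror u) (mirror v) = dot u v := by
  simp [dot]

lemma cross_mirror (u v : Plane) : cross (mirror u) (mirror v) = -cross u v := by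
  simp [cross]; ring

@[simp] lemma mirror_mirror (u : Plane) : mirror (mirror u) = u := by
  ext i; fin_cases i <;> simp

lemma plane_ext {u v : Plane} (h0 : u 0 = v 0) (h1 : u 1 = v 1) : u = v := by
  ext i; fin_cases i <;> assumption

lemma dot_self_pos {u : Plane} (h : u ≠ 0) : 0 < dot u u := by
  have h0 : 0 ≤ dot u u := by unfold dot; nlinarith [sq_nonneg (u 0), sq_nonneg (u 1)]
  refine lt_of_le_of_ne h0 fun h' => h ?_
  unfold dot at h'
  refine plane_ext ?_ ?_
  · show u 0 = 0
    nlinarith [sq_nonneg (u 0), sq_nonneg (u 1)]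
  · show u 1 = 0
    nlinarith [sq_nonneg (u 0), sq_nonneg (u 1)]

lemma dot_comm (u v : Plane) : dot u v = dot v u := by unfold dot; ring

lemma cross_comm (u v : Plane) : cross u v = -cross v u := by unfold cross; ring

lemma dot_sq_le (u v : Plane) : dot u v ^ 2 ≤ dot u u * dot v v := by
  unfold dot; nlinarith [sq_nonneg (u 0 * v 1 - u 1 * v 0)]

/-- Among the points of a circle whose product with `P` is at least that of `e`, the point `e`
with `0 ≤ cross P e` is the counterclockwise end. -/
lemma cross_nonpos_of_dot_le {a e P : Plane} (hae : dot a a = dot e e) (he : 0 < dot e P)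
    (hx : 0 ≤ cross P e) (ha : dot e P ≤ dot a P) :
    cross e a ≤ 0 ∧ (cross e a = 0 → a = e) := by
  have hP : P ≠ 0 := by rintro rfl; simp [dot] at he
  have hPP := dot_self_pos hP
  -- The products with `P` are coordinates in the frame of `P` and its normal. On a fixed circle a
  -- larger `dot a P` means a smaller `|cross P a|`, so `a` cannot be counterclockwise of `e`.
  have key : dot P P * cross e a = dot e P * cross P a - cross P e * dot a P := by
    unfold dot cross; ring
  have hsq : cross P a ^ 2 + dot a P ^ 2 = cross P e ^ 2 + dot e P ^ 2 := by
    have h1 : cross P a ^ 2 + dot a P ^ 2 = dot P P * dot a a := by unfold dot cross; ring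
    have h2 : cross P e ^ 2 + dot e P ^ 2 = dot P P * dot e e := by unfold dot cross; ring
    rw [h1, h2, hae]
  have hle : cross P a ≤ cross P e := by
    apply le_of_sq_le_sq _ hx
    nlinarith
  have h1 : dot e P * cross P a ≤ dot e P * cross P e := by gcongr
  have h2 : cross P e * dot e P ≤ cross P e * dot a P := by gcongr
  refine ⟨by nlinarith, fun h0 => ?_⟩
  rw [h0, mul_zero] at key
  have h3 : dot e P * cross P a = dot e P * cross P e := by linarith
  have h4 : cross P a = cross P e := mul_left_cancel₀ he.ne' h3
  have h5 : dot a P = dot e P := by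
    rw [h4] at hsq
    nlinarith
  have e0 : dot P P * a 0 = dot P P * e 0 := by
    have i1 : dot P P * a 0 = dot a P * P 0 - cross P a * P 1 := by unfold dot cross; ring
    have i2 : dot P P * e 0 = dot e P * P 0 - cross P e * P 1 := by unfold dot cross; ring
    rw [i1, i2, h4, h5]
  have e1 : dot P P * a 1 = dot P P * e 1 := by
    have i1 : dot P P * a 1 = dot a P * P 1 + cross P a * P 0 := by unfold dot cross; ring
    have i2 : dot P P * e 1 = dot e P * P 1 + cross P e * P 0 := by unfold dot cross; ring
    rw [i1, i2, h4, h5]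
  exact plane_ext (mul_left_cancel₀ hPP.ne' e0) (mul_left_cancel₀ hPP.ne' e1)

lemma cross_nonneg_of_dot_le {a e P : Plane} (hae : dot a a = dot e e) (he : 0 < dot e P)
    (hx : cross P e ≤ 0) (ha : dot e P ≤ dot a P) :
    0 ≤ cross e a ∧ (cross e a = 0 → a = e) := by
  have := cross_nonpos_of_dot_le (a := mirror a) (e := mirror e) (P := mirror P)
    (by simpa [dot_mirror] using hae) (by simpa [dot_mirror] using he)
    (by simpa [cross_mirror] using hx) (by simpa [dot_mirror] using ha)
  rw [cross_mirror] at this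
  refine ⟨by linarith [this.1], fun h => ?_⟩
  have h' := this.2 (by linarith)
  simpa using congrArg mirror h'

/-! ### Turning a disk about a point of its boundary -/

/-- A circle through the origin whose center lies between the centers `b` and `a` of two such
circles of the same radius contains the intersection of their disks. -/
lemma cap_between {r : ℝ} (hr : 0 < r) {a b e x : Plane} (ha : dot a a = r ^ 2)
    (hb : dot b b = r ^ 2) (he : dot e e = r ^ 2) (hba : cross b a < 0) (hbe : cross b e ≤ 0)
    (hea : cross e a ≤ 0) (hxa : dot x x ≤ 2 * dot a x) (hxb : dot x x ≤ 2 * dot b x) :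
    dot x x ≤ 2 * dot e x := by
  -- Cramer's rule: `e = l a + m b` with nonnegative coefficients.
  set l := cross b e / cross b a with hl
  set m := cross e a / cross b a with hm
  have hl0 : 0 ≤ l := div_nonneg_of_nonpos hbe hba.le
  have hm0 : 0 ≤ m := div_nonneg_of_nonpos hea hba.le
  have hl' : l * cross b a = cross b e := div_mul_cancel₀ _ hba.ne
  have hm' : m * cross b a = cross e a := div_mul_cancel₀ _ hba.ne
  have e0 : e 0 = l * a 0 + m * b 0 := by
    apply mul_left_cancel₀ hba.ne
    have : cross b a * e 0 = cross b e * a 0 + cross e a * b 0 := by unfold cross; ring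
    linear_combination this - a 0 * hl' - b 0 * hm'
  have e1 : e 1 = l * a 1 + m * b 1 := by
    apply mul_left_cancel₀ hba.ne
    have : cross b a * e 1 = cross b e * a 1 + cross e a * b 1 := by unfold cross; ring
    linear_combination this - a 1 * hl' - b 1 * hm'
  have hab : dot a b ≤ r ^ 2 := by
    have : dot a b ^ 2 ≤ (r ^ 2) ^ 2 := by
      have := dot_sq_le a b
      rw [ha, hb] at this; nlinarith
    exact le_of_sq_le_sq this (by positivity)
  have hee : r ^ 2 = l ^ 2 * r ^ 2 + m ^ 2 * r ^ 2 + 2 * (l * m) * dot a b := by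
    have : dot e e = l ^ 2 * dot a a + m ^ 2 * dot b b + 2 * (l * m) * dot a b := by
      unfold dot; rw [e0, e1]; ring
    rwa [he, ha, hb] at this
  -- The triangle inequality, as `a`, `b`, `e` have the same length. Therefore `x·x ≤ (l + m) x·x ≤
  -- 2 e·x`.
  have h1 : 1 ≤ l + m := by
    have h2 : l * m * dot a b ≤ l * m * r ^ 2 := by gcongr
    have h3 : (1 : ℝ) * r ^ 2 ≤ (l + m) ^ 2 * r ^ 2 := by nlinarith
    have h4 : (1 : ℝ) ≤ (l + m) ^ 2 := le_of_mul_le_mul_right h3 (by positivity)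
    nlinarith [add_nonneg hl0 hm0]
  have hx0 : 0 ≤ dot x x := by unfold dot; nlinarith [sq_nonneg (x 0), sq_nonneg (x 1)]
  have hex : dot e x = l * dot a x + m * dot b x := by
    unfold dot; rw [e0, e1]; ring
  rw [hex]
  nlinarith [mul_le_mul_of_nonneg_left hxa hl0, mul_le_mul_of_nonneg_left hxb hm0]

/-- The center of a circle of radius `r` through the origin and `P`. -/
lemma exists_center {r : ℝ} {P : Plane} (hP : P ≠ 0) (h : dot P P ≤ 4 * r ^ 2) :
    ∃ e : Plane, dot e e = r ^ 2 ∧ 2 * dot e P = dot P P ∧ 0 ≤ cross P e := by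
  have hPP := dot_self_pos hP
  -- The center is the midpoint of the chord plus `h'` times the normal of `P`; Pythagoras
  -- determines `h'`.
  set h' := Real.sqrt (r ^ 2 / dot P P - 1 / 4) with hh
  have hn : 0 ≤ r ^ 2 / dot P P - 1 / 4 := by
    rw [sub_nonneg, le_div_iff₀ hPP]; linarith
  have hs : h' ^ 2 = r ^ 2 / dot P P - 1 / 4 := Real.sq_sqrt hn
  have h0 : 0 ≤ h' := Real.sqrt_nonneg _
  refine ⟨!₂[P 0 / 2 - h' * P 1, P 1 / 2 + h' * P 0], ?_, ?_, ?_⟩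
  · have : dot !₂[P 0 / 2 - h' * P 1, P 1 / 2 + h' * P 0] !₂[P 0 / 2 - h' * P 1, P 1 / 2 + h' * P 0]
        = dot P P * (h' ^ 2 + 1 / 4) := by simp [dot]; ring
    rw [this, hs]; field_simp; ring
  · simp [dot]; ring
  · have : cross P !₂[P 0 / 2 - h' * P 1, P 1 / 2 + h' * P 0] = h' * dot P P := by
      simp [dot, cross]; ring
    rw [this]; positivity

lemma dot_self_le_of_dot_le {r : ℝ} {c P : Plane} (hc : dot c c = r ^ 2)
    (h : dot P P ≤ 2 * dot c P) : dot P P ≤ 4 * r ^ 2 := by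
  have h1 := dot_sq_le c P
  rw [hc] at h1
  have h0 : 0 ≤ dot P P := by unfold dot; nlinarith [sq_nonneg (P 0), sq_nonneg (P 1)]
  have h2 : dot P P * dot P P ≤ dot P P * (4 * r ^ 2) := by nlinarith
  rcases h0.eq_or_lt with h3 | h3
  · rw [← h3]; positivity
  · exact le_of_mul_le_mul_left h2 h3

/-- Turning clockwise about the origin from the center `b` of a disk that misses `P` to the center
`c` of a disk that contains `P`, one meets the center of a circle through `P`. -/
lemma exists_center_between {r : ℝ} (hr : 0 < r) {U b c P : Plane} (hU : U ≠ 0)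
    (hb : dot b b = r ^ 2) (hbU : 2 * dot b U = dot U U) (hUb : 0 ≤ cross U b)
    (hc : dot c c = r ^ 2) (hcU : dot U U ≤ 2 * dot c U) (hP : P ≠ 0)
    (hbP : 2 * dot b P < dot P P) (hcP : dot P P ≤ 2 * dot c P) :
    ∃ e : Plane, dot e e = r ^ 2 ∧ 2 * dot e P = dot P P ∧ 0 ≤ cross P e ∧
      ∀ x, dot x x ≤ 2 * dot b x → dot x x ≤ 2 * dot c x → dot x x ≤ 2 * dot e x := by
  obtain ⟨e, he, heP, hPe⟩ := exists_center hP (dot_self_le_of_dot_le hc hcP)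
  have hUU := dot_self_pos hU
  have hPP := dot_self_pos hP
  obtain ⟨hbc, hbc'⟩ := cross_nonpos_of_dot_le (hc.trans hb.symm) (by linarith) hUb
    (by linarith : dot b U ≤ dot c U)
  have hbc : cross b c < 0 := by
    refine lt_of_le_of_ne hbc fun h => ?_
    rw [hbc' h] at hcP
    linarith
  obtain ⟨hec, hec'⟩ := cross_nonpos_of_dot_le (hc.trans he.symm) (by linarith) hPe
    (by linarith : dot e P ≤ dot c P)
  -- Otherwise `b` lies between `e` and `c`. Both of their disks contain `P`, hence so would the
  -- disk around `b`.
  have hbe : cross b e ≤ 0 := by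
    by_contra! hbe
    have hec : cross e c < 0 := by
      refine lt_of_le_of_ne hec fun h => ?_
      rw [hec' h] at hbc
      linarith
    have := cap_between hr hc he hb hec (by rw [cross_comm]; linarith) hbc.le hcP heP.symm.le
    linarith
  exact ⟨e, he, heP, hPe, fun x hxb hxc => cap_between hr hc hb he hbc hbe hec hxc hxb⟩

/-- The mirror image of `exists_center_between`, for turning counterclockwise. -/
lemma exists_center_between' {r : ℝ} (hr : 0 < r) {U b c P : Plane} (hU : U ≠ 0)
    (hb : dot b b = r ^ 2) (hbU : 2 * dot b U = dot U U) (hUb : cross U b ≤ 0)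
    (hc : dot c c = r ^ 2) (hcU : dot U U ≤ 2 * dot c U) (hP : P ≠ 0)
    (hbP : 2 * dot b P < dot P P) (hcP : dot P P ≤ 2 * dot c P) :
    ∃ e : Plane, dot e e = r ^ 2 ∧ 2 * dot e P = dot P P ∧ cross P e ≤ 0 ∧
      ∀ x, dot x x ≤ 2 * dot b x → dot x x ≤ 2 * dot c x → dot x x ≤ 2 * dot e x := by
  have hm : ∀ {u : Plane}, u ≠ 0 → mirror u ≠ 0 := by
    intro u hu h
    apply hu
    have := congrArg mirror h
    rw [mirror_mirror] at this
    rw [this]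
    exact plane_ext (by simp) (by simp)
  obtain ⟨e, he, heP, hPe, h⟩ := exists_center_between hr (U := mirror U) (b := mirror b)
    (c := mirror c) (P := mirror P) (hm hU) (by simpa [dot_mirror]) (by simpa [dot_mirror])
    (by simpa [cross_mirror]) (by simpa [dot_mirror]) (by simpa [dot_mirror]) (hm hP)
    (by simpa [dot_mirror]) (by simpa [dot_mirror])
  rw [← mirror_mirror e] at heP hPe h
  simp only [dot_mirror, cross_mirror] at heP hPe
  refine ⟨mirror e, by rwa [dot_mirror], heP, by linarith, fun x => ?_⟩
  have := h (mirror x)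
  simpa only [dot_mirror] using this

/-- A circle through the origin whose disk contains `U` and `U'` has its center between the two
extreme such centers `b` and `a`. -/
lemma cap_of_extreme {r : ℝ} (hr : 0 < r) {U U' a b m x : Plane} (hU : U ≠ 0) (hU' : U' ≠ 0)
    (hb : dot b b = r ^ 2) (hbU : 2 * dot b U = dot U U) (hUb : 0 ≤ cross U b)
    (ha : dot a a = r ^ 2) (haU : 2 * dot a U' = dot U' U') (hUa : cross U' a ≤ 0)
    (haU' : dot U U ≤ 2 * dot a U)
    (hm : dot m m = r ^ 2) (hmU : dot U U ≤ 2 * dot m U) (hmU' : dot U' U' ≤ 2 * dot m U')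
    (hxa : dot x x ≤ 2 * dot a x) (hxb : dot x x ≤ 2 * dot b x) : dot x x ≤ 2 * dot m x := by
  have h1 := dot_self_pos hU
  have h2 := dot_self_pos hU'
  obtain ⟨hba, hba'⟩ := cross_nonpos_of_dot_le (ha.trans hb.symm) (by linarith) hUb
    (by linarith : dot b U ≤ dot a U)
  obtain ⟨hbm, hbm'⟩ := cross_nonpos_of_dot_le (hm.trans hb.symm) (by linarith) hUb
    (by linarith : dot b U ≤ dot m U)
  obtain ⟨ham, -⟩ := cross_nonneg_of_dot_le (hm.trans ha.symm) (by linarith) hUa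
    (by linarith : dot a U' ≤ dot m U')
  rcases hba.lt_or_eq with h | h
  · exact cap_between hr ha hb hm h hbm (by rw [cross_comm]; linarith) hxa hxb
  · rw [hba' h] at ham
    rw [hbm' (by linarith)]
    exact hxb

/-- The circular segment of a disk beyond a chord `v w` is contained in every disk of the same
radius through which the chord runs. The origin is the center of the first disk. -/
lemma segment_subset {r : ℝ} {v w q x : Plane} (hv : dot v v = r ^ 2)
    (hw : dot w w = r ^ 2) (hvw : v ≠ w) (hq : dot q q ≤ r ^ 2) (hc : 0 ≤ cross (w - v) v)
    (hqc : 0 ≤ cross (w - v) (q - v)) (hxv : dot x x ≤ 2 * dot v x)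
    (hxw : dot x x ≤ 2 * dot w x) : dot x x ≤ 2 * dot q x := by
  have hx0 : 0 ≤ dot x x := by unfold dot; nlinarith [sq_nonneg (x 0), sq_nonneg (x 1)]
  have hwv : cross (w - v) v = cross w v := by simp [cross]; ring
  rw [hwv] at hc
  -- If the chord is a diameter, only the disk itself contains both ends, so `x = 0`. Otherwise `q`
  -- is expanded in the basis `v`, `w`, dually to `cap_between`.
  rcases hc.eq_or_lt with hc | hc
  · have hop : w = -v := by
      have hd : dot v w ^ 2 = (r ^ 2) ^ 2 := by
        have : dot v w ^ 2 + cross w v ^ 2 = dot v v * dot w w := by unfold dot cross; ring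
        rw [← hc, hv, hw] at this; linarith
      rcases sq_eq_sq_iff_eq_or_eq_neg.1 hd with h | h
      · exfalso
        apply hvw
        have : dot (v - w) (v - w) = 0 := by
          have : dot (v - w) (v - w) = dot v v + dot w w - 2 * dot v w := by simp [dot]; ring
          rw [this, hv, hw, h]; ring
        by_contra hne
        exact (dot_self_pos (sub_ne_zero.2 hne)).ne' this
      · have : dot (v + w) (v + w) = 0 := by
          have : dot (v + w) (v + w) = dot v v + dot w w + 2 * dot v w := by simp [dot]; ring
          rw [this, hv, hw, h]; ring
        by_contra hne
        have hne' : v + w ≠ 0 := fun h0 => hne (eq_neg_of_add_eq_zero_right h0)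
        exact (dot_self_pos hne').ne' this
    have hneg : dot w x = -dot v x := by rw [hop]; simp [dot]; ring
    have hxx : x = 0 := by
      by_contra hne
      have := dot_self_pos hne
      linarith
    simp [hxx, dot]
  · set l := cross w q / cross w v with hl
    set m := cross q v / cross w v with hm
    have hl' : l * cross w v = cross w q := div_mul_cancel₀ _ hc.ne'
    have hm' : m * cross w v = cross q v := div_mul_cancel₀ _ hc.ne'
    have e0 : q 0 = l * v 0 + m * w 0 := by
      apply mul_left_cancel₀ hc.ne'
      have : cross w v * q 0 = cross w q * v 0 + cross q v * w 0 := by unfold cross; ring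
      linear_combination this - v 0 * hl' - w 0 * hm'
    have e1 : q 1 = l * v 1 + m * w 1 := by
      apply mul_left_cancel₀ hc.ne'
      have : cross w v * q 1 = cross w q * v 1 + cross q v * w 1 := by unfold cross; ring
      linear_combination this - v 1 * hl' - w 1 * hm'
    have hlm : 1 ≤ l + m := by
      rw [hl, hm, ← add_div, le_div_iff₀ hc]
      have : cross (w - v) (q - v) = cross w q + cross q v - cross w v := by simp [cross]; ring
      linarith
    have hvwd : 0 < dot (v - w) (v - w) := dot_self_pos (sub_ne_zero.2 hvw)
    have hvw1 : dot (v - w) (v - w) = 2 * r ^ 2 - 2 * dot v w := by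
      have : dot (v - w) (v - w) = dot v v + dot w w - 2 * dot v w := by simp [dot]; ring
      rw [this, hv, hw]; ring
    -- Lying beyond the chord means `l + m ≥ 1`; then `|q| ≤ r` forces `l m ≥ 0`, so both
    -- coefficients are nonnegative.
    have hqq : dot q q = (l + m) ^ 2 * r ^ 2 - l * m * dot (v - w) (v - w) := by
      rw [hvw1]
      have : dot q q = l ^ 2 * dot v v + m ^ 2 * dot w w + 2 * (l * m) * dot v w := by
        unfold dot; rw [e0, e1]; ring
      rw [this, hv, hw]; ring
    have hlm0 : 0 ≤ l * m := by
      by_contra! h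
      have h1 : r ^ 2 ≤ (l + m) ^ 2 * r ^ 2 := by
        have : 1 ≤ (l + m) ^ 2 := by nlinarith
        nlinarith [sq_nonneg r]
      nlinarith [mul_pos (neg_pos.2 h) hvwd]
    have hl0 : 0 ≤ l := by
      by_contra! h
      have : 0 < m := by linarith
      nlinarith [mul_pos (neg_pos.2 h) this]
    have hm0 : 0 ≤ m := by
      by_contra! h
      have : 0 < l := by linarith
      nlinarith [mul_pos (neg_pos.2 h) this]
    have hqx : dot q x = l * dot v x + m * dot w x := by
      unfold dot; rw [e0, e1]; ring
    rw [hqx]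
    nlinarith [mul_le_mul_of_nonneg_left hxv hl0, mul_le_mul_of_nonneg_left hxw hm0]

/-! ### Membership in a disk without roots -/

/-- Whether the disk of radius `r` whose boundary runs clockwise along a minor arc from `v` to `w`
contains `p`, decided without roots. -/
def InDisk (r : ℝ) (v w p : Plane) : Prop :=
  0 < dot (w - v) (w - v) ∧
    ((cross (w - v) (p - v) ≤ 0 ∧
        0 ≤ dot (w - v) (w - v) * (dot (p - v) (w - v) - dot (p - v) (p - v))) ∨
      (cross (w - v) (p - v) ≤ 0 ∧
        (dot (w - v) (w - v) * (dot (p - v) (w - v) - dot (p - v) (p - v))) ^ 2 ≤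
          dot (w - v) (w - v) * (4 * r ^ 2 - dot (w - v) (w - v)) * cross (w - v) (p - v) ^ 2) ∨
      (0 ≤ dot (w - v) (w - v) * (dot (p - v) (w - v) - dot (p - v) (p - v)) ∧
        dot (w - v) (w - v) * (4 * r ^ 2 - dot (w - v) (w - v)) * cross (w - v) (p - v) ^ 2 ≤
          (dot (w - v) (w - v) * (dot (p - v) (w - v) - dot (p - v) (p - v))) ^ 2))

/-- After multiplication by `D = |W|²`, membership reads `2 s X ≤ Y`, where the only irrational
quantity `s ≥ 0` satisfies `4 s² = D (4 r² - D)`. The three alternatives of `InDisk` decide this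
from the signs of `X` and `Y` and a comparison of squares. -/
lemma inDisk_iff_dot {r : ℝ} {v w p a : Plane} (hvw : v ≠ w) (ha : dot a a = r ^ 2)
    (haw : 2 * dot a (w - v) = dot (w - v) (w - v)) (hwa : cross (w - v) a ≤ 0) :
    InDisk r v w p ↔ dot (p - v) (p - v) ≤ 2 * dot a (p - v) := by
  have hD : 0 < dot (w - v) (w - v) := dot_self_pos (sub_ne_zero.2 hvw.symm)
  unfold InDisk
  generalize w - v = W at *
  generalize p - v = P at *
  set D := dot W W with hDd
  set s := -cross W a with hs
  set X := cross W P with hX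
  set Y := D * (dot P W - dot P P) with hY
  have hs0 : 0 ≤ s := by linarith
  have hs2 : 4 * s ^ 2 = D * (4 * r ^ 2 - D) := by
    have : cross W a ^ 2 + dot a W ^ 2 = dot W W * dot a a := by unfold dot cross; ring
    rw [ha] at this
    rw [hs, neg_sq]
    nlinarith
  have key : D * (2 * dot a P - dot P P) = Y - 2 * s * X := by
    have : dot W W * dot a P = dot a W * dot P W + cross W a * cross W P := by
      unfold dot cross; ring
    rw [hY, hs]
    rw [← hDd] at this
    linear_combination 2 * this + haw * dot P W
  have hiff : dot P P ≤ 2 * dot a P ↔ 2 * s * X ≤ Y := by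
    constructor
    · intro h; nlinarith
    · intro h
      have : 0 ≤ D * (2 * dot a P - dot P P) := by rw [key]; linarith
      have := nonneg_of_mul_nonneg_right this hD
      linarith
  rw [hiff, ← hs2]
  have hsq : 4 * s ^ 2 * X ^ 2 = (2 * s * X) ^ 2 := by ring
  rw [hsq]
  constructor
  · rintro ⟨-, ⟨h1, h2⟩ | ⟨h1, h2⟩ | ⟨h1, h2⟩⟩
    · nlinarith [mul_nonneg hs0 (neg_nonneg.2 h1)]
    · have h3 : 0 ≤ -(2 * s * X) := by nlinarith [mul_nonneg hs0 (neg_nonneg.2 h1)]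
      have := abs_le_of_sq_le_sq' (by rwa [neg_sq] : Y ^ 2 ≤ (-(2 * s * X)) ^ 2) h3
      linarith [this.1]
    · exact le_of_sq_le_sq h2 h1
  · intro h
    refine ⟨hD, ?_⟩
    by_cases hX0 : X ≤ 0
    · by_cases hY0 : 0 ≤ Y
      · exact Or.inl ⟨hX0, hY0⟩
      · refine Or.inr (Or.inl ⟨hX0, ?_⟩)
        push Not at hY0
        nlinarith
    · push Not at hX0
      have h0 : 0 ≤ 2 * s * X := by positivity
      exact Or.inr (Or.inr ⟨by linarith, by gcongr⟩)

end CircularHull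

namespace CircularHull

/-! ### Disks through given points -/

lemma dist_sq (x y : Plane) : dist x y ^ 2 = dot (x - y) (x - y) := by
  rw [EuclideanSpace.dist_eq, Real.sq_sqrt (by positivity)]
  simp [Real.dist_eq, dot, Fin.sum_univ_two]; ring

lemma dist_le_iff {r : ℝ} (hr : 0 < r) {x y : Plane} :
    dist x y ≤ r ↔ dot (x - y) (x - y) ≤ r ^ 2 := by
  rw [← dist_sq, sq_le_sq₀ dist_nonneg hr.le]

lemma dist_eq_iff {r : ℝ} (hr : 0 < r) {x y : Plane} :
    dist x y = r ↔ dot (x - y) (x - y) = r ^ 2 := by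
  rw [← dist_sq, sq_eq_sq₀ dist_nonneg hr.le]

lemma dist_eq_iff' {r : ℝ} (hr : 0 < r) {x y : Plane} :
    dist x y = r ↔ dot (y - x) (y - x) = r ^ 2 := by
  rw [dist_comm, dist_eq_iff hr]

lemma dot_sub_expand (q c v : Plane) : dot (q - c) (q - c) =
    dot (q - v) (q - v) - 2 * dot (c - v) (q - v) + dot (c - v) (c - v) := by
  simp [dot]; ring

/-- With `v` on the circle as origin, membership in the disk becomes linear in the center; this is
the form used in all turning arguments. -/
lemma dist_le_iff_dot {r : ℝ} (hr : 0 < r) {v c q : Plane} (h : dist v c = r) :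
    dist q c ≤ r ↔ dot (q - v) (q - v) ≤ 2 * dot (c - v) (q - v) := by
  rw [dist_eq_iff' hr] at h
  rw [dist_le_iff hr, dot_sub_expand q c v, h]
  constructor <;> intro h' <;> linarith

lemma dist_eq_iff_dot {r : ℝ} (hr : 0 < r) {v c q : Plane} (h : dist v c = r) :
    dist q c = r ↔ 2 * dot (c - v) (q - v) = dot (q - v) (q - v) := by
  rw [dist_eq_iff' hr] at h
  rw [dist_eq_iff hr, dot_sub_expand q c v, h]
  constructor <;> intro h' <;> linarith

lemma cross_sub_swap (u v c : Plane) : cross (v - u) (c - u) = -cross (u - v) (c - v) := by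
  simp [cross]; ring

/-- The centers of the disks of radius `r` containing `Q`. -/
def Centers (r : ℝ) (Q : Set Plane) : Set Plane := {c | ∀ q ∈ Q, dist q c ≤ r}

lemma hullExists_iff {r : ℝ} {Q : Set Plane} : HullExists r Q ↔ (Centers r Q).Nonempty :=
  Iff.rfl

lemma mem_hull_iff {r : ℝ} {Q : Set Plane} {x : Plane} :
    x ∈ hull r Q ↔ ∀ c ∈ Centers r Q, dist x c ≤ r := by
  simp only [hull, Set.mem_iInter, Metric.mem_closedBall]
  rfl

lemma mem_centers_insert {r : ℝ} {Q : Set Plane} {p c : Plane} :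
    c ∈ Centers r (insert p Q) ↔ dist p c ≤ r ∧ c ∈ Centers r Q := by
  simp [Centers]

lemma centers_eq_iInter (r : ℝ) (Q : Set Plane) :
    Centers r Q = ⋂ q ∈ Q, Metric.closedBall q r := by
  ext c; simp [Centers, dist_comm]

lemma convex_centers (r : ℝ) (Q : Set Plane) : Convex ℝ (Centers r Q) := by
  rw [centers_eq_iInter]
  exact convex_iInter₂ fun q _ => convex_closedBall q r

lemma isCompact_centers {r : ℝ} {Q : Set Plane} (hQ : Q.Nonempty) :
    IsCompact (Centers r Q) := by
  obtain ⟨q, hq⟩ := hQ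
  refine (isCompact_closedBall q r).of_isClosed_subset ?_ ?_
  · rw [centers_eq_iInter]
    exact isClosed_biInter fun q _ => Metric.isClosed_closedBall
  · intro c hc
    rw [Metric.mem_closedBall, dist_comm]
    exact hc q hq

lemma mem_frontier_hull {r : ℝ} (hr : 0 < r) {Q : Set Plane} {c t : Plane}
    (hc : c ∈ Centers r Q) (ht : t ∈ hull r Q) (htc : dist t c = r) :
    t ∈ frontier (hull r Q) := by
  refine ⟨subset_closure ht, fun hi => ?_⟩
  have h1 : hull r Q ⊆ Metric.closedBall c r := fun x hx => mem_hull_iff.1 hx c hc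
  have h2 := interior_mono h1 hi
  rw [interior_closedBall c hr.ne', Metric.mem_ball] at h2
  exact h2.ne htc

/-- If no circle passes through `q`, compactness of the set of centers bounds the distances from `q`
away from `r`, and a neighborhood of `q` lies in the hull. Conversely, a point on the circle is not
interior to that disk. -/
lemma mem_vertices_iff {r : ℝ} (hr : 0 < r) {Q : Set Plane} (hK : (Centers r Q).Nonempty)
    {q : Plane} : q ∈ vertices r Q ↔ q ∈ Q ∧ ∃ c ∈ Centers r Q, dist q c = r := by
  constructor
  · rintro ⟨hq, hf⟩
    refine ⟨hq, ?_⟩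
    by_contra! h
    obtain ⟨c, hc, hmax⟩ := (isCompact_centers (r := r) ⟨q, hq⟩).exists_isMaxOn hK
      (f := fun c => dist q c) (by fun_prop)
    have hlt : dist q c < r := lt_of_le_of_ne (hc q hq) (h c hc)
    apply hf.2
    rw [mem_interior_iff_mem_nhds, Metric.mem_nhds_iff]
    refine ⟨r - dist q c, by linarith, fun x hx => mem_hull_iff.2 fun c' hc' => ?_⟩
    rw [Metric.mem_ball] at hx
    have h1 : dist q c' ≤ dist q c := hmax hc'
    linarith [dist_triangle x q c']
  · rintro ⟨hq, c, hc, hqc⟩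
    exact ⟨hq, mem_frontier_hull hr hc (mem_hull_iff.2 fun c' hc' => hc' q hq) hqc⟩

/-! ### Boundary arcs and their fate under an insertion -/

/-- The points `v`, `w` of `Q` are joined by a clockwise minor arc around `c`, and the disk
around `c` contains `Q`. -/
structure Arc (r : ℝ) (Q : Set Plane) (v w c : Plane) : Prop where
  left_mem : v ∈ Q
  right_mem : w ∈ Q
  ne : v ≠ w
  center : c ∈ Centers r Q
  dist_left : dist v c = r
  dist_right : dist w c = r
  cross_nonpos : cross (w - v) (c - v) ≤ 0

variable {r : ℝ} {Q : Set Plane} {u v w p q b c : Plane}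

namespace Arc

lemma left_vertex (hr : 0 < r) (h : Arc r Q v w c) : v ∈ vertices r Q :=
  (mem_vertices_iff hr ⟨c, h.center⟩).2 ⟨h.left_mem, c, h.center, h.dist_left⟩

lemma right_vertex (hr : 0 < r) (h : Arc r Q v w c) : w ∈ vertices r Q :=
  (mem_vertices_iff hr ⟨c, h.center⟩).2 ⟨h.right_mem, c, h.center, h.dist_right⟩

lemma insert (h : Arc r Q v w c) (hp : dist p c ≤ r) : Arc r (insert p Q) v w c :=
  ⟨Or.inr h.left_mem, Or.inr h.right_mem, h.ne, mem_centers_insert.2 ⟨hp, h.center⟩,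
    h.dist_left, h.dist_right, h.cross_nonpos⟩

lemma inDisk_iff (hr : 0 < r) (h : Arc r Q v w c) : InDisk r v w p ↔ dist p c ≤ r := by
  rw [dist_le_iff_dot hr h.dist_left]
  exact inDisk_iff_dot h.ne ((dist_eq_iff' hr).1 h.dist_left)
    ((dist_eq_iff_dot hr h.dist_left).1 h.dist_right) h.cross_nonpos

/-- `segment_subset` with `c` as origin. The conclusion says that `t` is at least as close to `c'`
as to `c`, which is stronger than membership in the disk around `c'` and gives the equality case
needed in `cross_neg`. -/
lemma segment (hr : 0 < r) {c' t : Plane} (hvw : v ≠ w) (hv : dist v c = r) (hw : dist w c = r)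
    (hc : cross (w - v) (c - v) ≤ 0) (ht : dist t c ≤ r) (htv : 0 ≤ cross (w - v) (t - v))
    (hv' : dist v c' ≤ r) (hw' : dist w c' ≤ r) :
    dot (c' - c) (c' - c) ≤ 2 * dot (t - c) (c' - c) := by
  have hx : ∀ x : Plane, dist x c = r → dist x c' ≤ r →
      dot (c' - c) (c' - c) ≤ 2 * dot (x - c) (c' - c) := by
    intro x hx hx'
    rw [dist_le_iff hr] at hx'
    rw [dist_eq_iff hr] at hx
    rw [dot_sub_expand x c' c, hx, dot_comm (c' - c)] at hx'
    linarith
  have e1 : w - c - (v - c) = w - v := by abel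
  have e2 : t - c - (v - c) = t - v := by abel
  refine segment_subset ((dist_eq_iff hr).1 hv) ((dist_eq_iff hr).1 hw)
    (fun h => hvw (sub_left_inj.1 h)) ((dist_le_iff hr).1 ht) ?_ ?_ (hx v hv hv') (hx w hw hw')
  · rw [e1, ← neg_sub c v]
    have : cross (w - v) (-(c - v)) = -cross (w - v) (c - v) := by simp [cross]; ring
    rw [this]; linarith
  · rwa [e1, e2]

/-- The center in `cwArc` is arbitrary, but two centers on the same side of the chord are both the
clockwise extreme, hence equal. By `segment` the arc then lies in every disk containing `Q`, and it
lies on one of the circles. -/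
lemma isClockwiseNeighbor (hr : 0 < r) (h : Arc r Q v w c) : IsClockwiseNeighbor r Q v w := by
  refine ⟨h.left_vertex hr, h.right_vertex hr, h.ne, ?_⟩
  rintro t ⟨d, hvd, hwd, hd, htd, ht⟩
  have hcd : d = c := by
    have h1 := (dist_eq_iff_dot hr hvd).1 hwd
    have h2 := (dist_eq_iff_dot hr h.dist_left).1 h.dist_right
    have hpos := dot_self_pos (sub_ne_zero.2 h.ne.symm)
    have h3 := h.cross_nonpos
    have e1 := (dist_eq_iff' hr).1 hvd
    have e2 := (dist_eq_iff' hr).1 h.dist_left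
    have k1 := cross_nonneg_of_dot_le (a := d - v) (e := c - v) (P := w - v)
      (by rw [e1, e2]) (by linarith) h3 (by linarith)
    have k2 := cross_nonneg_of_dot_le (a := c - v) (e := d - v) (P := w - v)
      (by rw [e1, e2]) (by linarith) hd (by linarith)
    have := k1.2 (by rw [cross_comm] at k2; linarith [k1.1, k2.1])
    exact sub_left_inj.1 this
  subst hcd
  refine mem_frontier_hull hr h.center (mem_hull_iff.2 fun c' hc' => ?_) htd
  have := segment hr h.ne hvd hwd hd htd.le ht (hc' v h.left_mem) (hc' w h.right_mem)
  rw [dist_le_iff hr, dot_sub_expand t c' d, (dist_eq_iff hr).1 htd, dot_comm (c' - d)]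
  linarith

/-- Vertices other than `v` and `w` lie to the right of the line from `v` to its clockwise
neighbor `w`. -/
lemma cross_neg (hr : 0 < r) (hQ : GeneralPosition r Q) (h : Arc r Q v w c)
    (hq : q ∈ vertices r Q) (hqv : q ≠ v) (hqw : q ≠ w) : cross (w - v) (q - v) < 0 := by
  by_contra! hneg
  obtain ⟨hqQ, c', hc', hqc'⟩ := (mem_vertices_iff hr ⟨c, h.center⟩).1 hq
  have := segment hr h.ne h.dist_left h.dist_right h.cross_nonpos (h.center q hqQ) hneg
    (hc' v h.left_mem) (hc' w h.right_mem)
  have h1 := (dist_eq_iff hr).1 hqc'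
  rw [dot_sub_expand q c' c, dot_comm (c' - c)] at h1
  have h2 := (dist_le_iff hr).1 (h.center q hqQ)
  have h3 : dist q c = r := (dist_eq_iff hr).2 (by linarith)
  exact hQ v h.left_mem w h.right_mem q hqQ h.ne hqv hqw
    ⟨c, h.dist_left, h.dist_right, h.cross_nonpos, h3, hneg⟩

/-- In general position, a clockwise neighbor is unique. -/
lemma unique (hr : 0 < r) (hQ : GeneralPosition r Q) {c' : Plane} (h : Arc r Q p v c)
    (h' : Arc r Q p w c') : v = w := by
  have h1 := (dist_eq_iff_dot hr h.dist_left).1 h.dist_right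
  have h2 := (dist_eq_iff_dot hr h'.dist_left).1 h'.dist_right
  have h3 := (dist_le_iff_dot hr h.dist_left).1 (h.center w h'.right_mem)
  have h4 := (dist_le_iff_dot hr h'.dist_left).1 (h'.center v h.right_mem)
  have hv := dot_self_pos (sub_ne_zero.2 h.ne.symm)
  have hw := dot_self_pos (sub_ne_zero.2 h'.ne.symm)
  have e1 := (dist_eq_iff' hr).1 h.dist_left
  have e2 := (dist_eq_iff' hr).1 h'.dist_left
  have k1 := cross_nonneg_of_dot_le (a := c' - p) (e := c - p) (P := v - p)
    (by rw [e1, e2]) (by linarith) h.cross_nonpos (by linarith)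
  have k2 := cross_nonneg_of_dot_le (a := c - p) (e := c' - p) (P := w - p)
    (by rw [e1, e2]) (by linarith) h'.cross_nonpos (by linarith)
  -- Each center is the clockwise extreme among the centers of disks through `p` that contain its
  -- own arc's other end, so neither is strictly clockwise of the other.
  have hcc : c' = c :=
    sub_left_inj.1 (k1.2 (by rw [cross_comm] at k2; linarith [k1.1, k2.1]))
  subst hcc
  by_contra hne
  -- Now `v` and `w` are on one circle through `p`, and one of them lies on the arc from `p` to the
  -- other.
  rcases le_total 0 (cross (v - p) (w - p)) with hx | hx
  · exact hQ p h.left_mem v h.right_mem w h'.right_mem h.ne h'.ne.symm (Ne.symm hne)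
      ⟨c', h.dist_left, h.dist_right, h.cross_nonpos, h'.dist_right, hx⟩
  · exact hQ p h'.left_mem w h'.right_mem v h.right_mem h'.ne h.ne.symm hne
      ⟨c', h'.dist_left, h'.dist_right, h'.cross_nonpos, h.dist_right,
        by rw [cross_comm]; linarith⟩

/-- If the arc that ends in `v` does not survive the insertion of `p`, but `v` does, then `v` is
the clockwise neighbor of `p`. -/
lemma insert_left (hr : 0 < r) (h : Arc r Q u v b) (hp : ¬ dist p b ≤ r)
    (hv : v ∈ vertices r (Insert.insert p Q)) (hK : (Centers r (Insert.insert p Q)).Nonempty) :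
    ∃ e, Arc r (Insert.insert p Q) p v e := by
  obtain ⟨-, c, hc, hvc⟩ := (mem_vertices_iff hr hK).1 hv
  rw [mem_centers_insert] at hc
  have hpv : p ≠ v := by
    rintro rfl
    exact hp h.dist_right.le
  have hUb := h.cross_nonpos
  rw [cross_sub_swap] at hUb
  -- With `v` as origin: `b` is the center of the lost arc, `c` witnesses that `v` survives. Both of
  -- their disks contain `Q`, hence so does the disk around the intermediate center `e`.
  obtain ⟨e, he, heP, hPe, hx⟩ := exists_center_between hr (sub_ne_zero.2 h.ne)
    ((dist_eq_iff' hr).1 h.dist_right) ((dist_eq_iff_dot hr h.dist_right).1 h.dist_left)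
    (by linarith) ((dist_eq_iff' hr).1 hvc)
    ((dist_le_iff_dot hr hvc).1 (hc.2 u h.left_mem)) (sub_ne_zero.2 hpv)
    (by rw [dist_le_iff_dot hr h.dist_right] at hp; linarith)
    ((dist_le_iff_dot hr hvc).1 hc.1)
  have hev : v + e - v = e := by abel
  have hve : dist v (v + e) = r := by rw [dist_eq_iff' hr, hev, he]
  have hpe : dist p (v + e) = r := by rw [dist_eq_iff_dot hr hve, hev, heP]
  refine ⟨v + e, Or.inl rfl, Or.inr h.right_mem, hpv, mem_centers_insert.2 ⟨hpe.le, ?_⟩, hpe,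
    hve, ?_⟩
  · intro q hq
    rw [dist_le_iff_dot hr hve, hev]
    exact hx _ ((dist_le_iff_dot hr h.dist_right).1 (h.center q hq))
      ((dist_le_iff_dot hr hvc).1 (hc.2 q hq))
  · rw [cross_sub_swap, hev]; linarith

/-- If the arc that starts in `v` does not survive the insertion of `p`, but `v` does, then `p` is
the clockwise neighbor of `v`. -/
lemma insert_right (hr : 0 < r) (h : Arc r Q v u b) (hp : ¬ dist p b ≤ r)
    (hv : v ∈ vertices r (Insert.insert p Q)) (hK : (Centers r (Insert.insert p Q)).Nonempty) :
    ∃ e, Arc r (Insert.insert p Q) v p e := by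
  obtain ⟨-, c, hc, hvc⟩ := (mem_vertices_iff hr hK).1 hv
  rw [mem_centers_insert] at hc
  have hpv : p ≠ v := by
    rintro rfl
    exact hp h.dist_left.le
  obtain ⟨e, he, heP, hPe, hx⟩ := exists_center_between' hr (sub_ne_zero.2 h.ne.symm)
    ((dist_eq_iff' hr).1 h.dist_left) ((dist_eq_iff_dot hr h.dist_left).1 h.dist_right)
    h.cross_nonpos ((dist_eq_iff' hr).1 hvc)
    ((dist_le_iff_dot hr hvc).1 (hc.2 u h.right_mem)) (sub_ne_zero.2 hpv)
    (by rw [dist_le_iff_dot hr h.dist_left] at hp; linarith)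
    ((dist_le_iff_dot hr hvc).1 hc.1)
  have hev : v + e - v = e := by abel
  have hve : dist v (v + e) = r := by rw [dist_eq_iff' hr, hev, he]
  have hpe : dist p (v + e) = r := by rw [dist_eq_iff_dot hr hve, hev, heP]
  refine ⟨v + e, Or.inr h.left_mem, Or.inl rfl, hpv.symm, mem_centers_insert.2 ⟨hpe.le, ?_⟩, hve,
    hpe, ?_⟩
  · intro q hq
    rw [dist_le_iff_dot hr hve, hev]
    exact hx _ ((dist_le_iff_dot hr h.dist_left).1 (h.center q hq))
      ((dist_le_iff_dot hr hvc).1 (hc.2 q hq))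
  · rwa [hev]

end Arc

/-- A point to the right of all vertices that lies in the disks of the two arcs at the rightmost
vertex is not a vertex. -/
lemma notMem_vertices_insert (hr : 0 < r) (hQ : GeneralPosition r (insert p Q))
    (h : Arc r Q v w c) (h' : Arc r Q u v b) (hc : dist p c ≤ r) (hb : dist p b ≤ r)
    (hw : w 0 < v 0) (hu : u 0 < v 0) (hp : v 0 < p 0) : p ∉ vertices r (insert p Q) := by
  intro hpv
  have ne : ∀ {x y : Plane}, x 0 < y 0 → y ≠ x := by rintro x y h rfl; exact h.false
  have h1 := (h.insert hc).cross_neg hr hQ hpv (ne hp) (ne (hw.trans hp))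
  have h2 := (h'.insert hb).cross_neg hr hQ hpv (ne (hu.trans hp)) (ne hp)
  have h3 : cross (w - v) (u - v) ≤ 0 := by
    by_cases huw : u = w
    · rw [huw]; simp [cross, mul_comm]
    · exact ((h.insert hc).cross_neg hr hQ ((h'.insert hb).left_vertex hr) h'.ne huw).le
  rw [cross_sub_swap] at h2
  -- The linear relation between three plane vectors, in `x`-coordinates. As `u` and `w` are to the
  -- left of `v` and `p` to the right, the three signs are incompatible.
  have key : cross (w - v) (u - v) * (p 0 - v 0) + cross (u - v) (p - v) * (w 0 - v 0) -
      cross (w - v) (p - v) * (u 0 - v 0) = 0 := by simp [cross]; ring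
  have i1 : cross (w - v) (u - v) * (p 0 - v 0) ≤ 0 :=
    mul_nonpos_of_nonpos_of_nonneg h3 (by linarith)
  have i2 : cross (u - v) (p - v) * (w 0 - v 0) < 0 :=
    mul_neg_of_pos_of_neg (by linarith) (by linarith)
  have i3 : 0 < cross (w - v) (p - v) * (u 0 - v 0) := mul_pos_of_neg_of_neg h1 (by linarith)
  linarith

/-! ### Vertices obtained by moving a center continuously -/

/-- A connected set that meets the set of centers but is not contained in it contains a center
whose circle passes through a point of `Q`. -/
lemma exists_dist_eq {S : Set Plane} (hS : IsPreconnected S) (hQ : Q.Finite) {x : Plane}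
    (hcS : c ∈ S) (hc : c ∈ Centers r Q) (hxS : x ∈ S) (hx : x ∉ Centers r Q) :
    ∃ e ∈ S, e ∈ Centers r Q ∧ ∃ q ∈ Q, dist q e = r := by
  have hx' : ∃ q ∈ Q, r < dist q x := by
    by_contra! h; exact hx h
  obtain ⟨q₀, hq₀, hq₀x⟩ := hx'
  have hne : hQ.toFinset.Nonempty := ⟨q₀, by simpa⟩
  set f : Plane → ℝ := fun e => hQ.toFinset.sup' hne fun q => dist q e with hf
  have hcont : Continuous f := Continuous.finset_sup'_apply hne fun q _ => by fun_prop
  have h1 : f c ≤ r := Finset.sup'_le _ _ fun q hq => hc q (by simpa using hq)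
  have h2 : r ≤ f x := hq₀x.le.trans
    (Finset.le_sup' (fun q => dist q x) (by simpa using hq₀))
  obtain ⟨e, heS, he⟩ := hS.intermediate_value hcS hxS hcont.continuousOn ⟨h1, h2⟩
  refine ⟨e, heS, fun q hq => ?_, ?_⟩
  · rw [← he]
    exact Finset.le_sup' (fun q => dist q e) (by simpa using hq)
  · obtain ⟨q, hq, hqe⟩ := Finset.exists_mem_eq_sup' hne fun q => dist q e
    exact ⟨q, by simpa using hq, by rw [← hqe]; exact he⟩

/-- The centers for `Q` form a convex set. If `p` were in some but not all of their disks, an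
intermediate center would have `p` on its circle, making `p` a vertex. -/
lemma centers_insert_of_notMem_vertices (hr : 0 < r)
    (hK : (Centers r (insert p Q)).Nonempty) (hp : p ∉ vertices r (insert p Q)) :
    Centers r (insert p Q) = Centers r Q := by
  ext x
  rw [mem_centers_insert, and_iff_right_iff_imp]
  intro hx
  by_contra hpx
  obtain ⟨c, hc⟩ := id hK
  rw [mem_centers_insert] at hc
  obtain ⟨e, he, -, q, hq, hqe⟩ := exists_dist_eq (Q := {p}) (r := r) (c := c)
    (convex_centers r Q).isPreconnected (Set.finite_singleton p) hc.2
    (by simpa [Centers] using hc.1) hx (by simpa [Centers] using hpx)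
  rw [Set.mem_singleton_iff] at hq
  subst hq
  exact hp ((mem_vertices_iff hr hK).2 ⟨Or.inl rfl, e, mem_centers_insert.2 ⟨hqe.le, he⟩, hqe⟩)

/-- Move a center, keeping `p` in the disk, until the disk is about to lose a point of `Q`; that
point is then on the circle. -/
lemma exists_vertex_insert (hr : 0 < r) (hQ : Q.Finite) (hq : q ∈ Q) (hpq : p ≠ q)
    (hK : (Centers r (insert p Q)).Nonempty) : ∃ v ∈ Q, v ∈ vertices r (insert p Q) := by
  obtain ⟨c, hc⟩ := id hK
  rw [mem_centers_insert] at hc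
  have hN : 0 < ‖p - q‖ := norm_pos_iff.2 (sub_ne_zero.2 hpq)
  -- This center lies at distance `r` from `p` on the side away from `q`, so its disk contains `p`
  -- but not `q`.
  set x := p + (r / ‖p - q‖) • (p - q) with hx
  have h1 : x ∈ Metric.closedBall p r := by
    rw [Metric.mem_closedBall, dist_eq_norm, hx, add_sub_cancel_left, norm_smul, Real.norm_eq_abs,
      abs_of_pos (by positivity), div_mul_cancel₀ _ hN.ne']
  have h2 : x ∉ Centers r Q := by
    intro h
    have := h q hq
    rw [dist_comm, dist_eq_norm] at this
    have e : x - q = (1 + r / ‖p - q‖) • (p - q) := by rw [hx, add_smul, one_smul]; abel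
    rw [e, norm_smul, Real.norm_eq_abs, abs_of_pos (by positivity), add_mul,
      div_mul_cancel₀ _ hN.ne'] at this
    linarith
  obtain ⟨e, he, heQ, v, hv, hve⟩ := exists_dist_eq (convex_closedBall p r).isPreconnected hQ
    (by rw [Metric.mem_closedBall, dist_comm]; exact hc.1) hc.2 h1 h2
  rw [Metric.mem_closedBall, dist_comm] at he
  exact ⟨v, hv, (mem_vertices_iff hr hK).2
    ⟨Or.inr hv, e, mem_centers_insert.2 ⟨he, heQ⟩, hve⟩⟩

/-- Whether the hull of `v` and `p` contains the neighbors `u` and `w` of `v`, provided that no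
arc at `v` survives the insertion of `p`. -/
def InLens (r : ℝ) (u v w p : Plane) : Prop :=
  dot (p - v) (p - v) ≤ 4 * r ^ 2 ∧ dot (u - v) (u - v) ≤ dot (p - v) (u - v) ∧
    dot (w - v) (w - v) ≤ dot (p - v) (w - v)

/-- The last two inequalities put `u` and `w` in the disk with diameter `v p`. The disk of radius
`r` touching that disk at `v` from outside it contains it, as `|p - v| ≤ 2 r`. It thus contains `u`,
`w` and `p`, and by `cap_of_extreme` all of `Q`, while `v` is on its circle. -/
lemma InLens.mem_vertices (hr : 0 < r) (h : InLens r u v w p) (hpv : p ≠ v) (h₁ : Arc r Q u v b)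
    (h₂ : Arc r Q v w c) :
    (Centers r (insert p Q)).Nonempty ∧ v ∈ vertices r (insert p Q) := by
  obtain ⟨hP, hu, hw⟩ := h
  have hN : 0 < dist p v := dist_pos.2 hpv
  have hN2 := dist_sq p v
  set N := dist p v with hNd
  have hNr : N ≤ 2 * r := by
    apply le_of_sq_le_sq _ (by positivity)
    nlinarith
  set m := (r / N) • (p - v) with hm
  have hmx : ∀ x, dot m x = r / N * dot (p - v) x := by intro x; simp [hm, dot]; ring
  have hmm : dot m m = r ^ 2 := by
    rw [hmx, dot_comm, hmx, ← hN2]; field_simp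
  have hle : ∀ x, dot x x ≤ dot (p - v) x → dot x x ≤ 2 * dot m x := by
    intro x hx
    have h0 : 0 ≤ dot x x := by unfold dot; nlinarith [sq_nonneg (x 0), sq_nonneg (x 1)]
    have h1 : 1 ≤ 2 * (r / N) := by
      rw [← mul_div_assoc, le_div_iff₀ hN]; linarith
    rw [hmx]
    nlinarith
  have hUb := h₁.cross_nonpos
  rw [cross_sub_swap] at hUb
  have hvm : v + m - v = m := by abel
  have hve : dist v (v + m) = r := by rw [dist_eq_iff' hr, hvm, hmm]
  have hK : v + m ∈ Centers r (insert p Q) := by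
    rw [mem_centers_insert]
    constructor
    · rw [dist_le_iff_dot hr hve, hvm]
      exact hle _ le_rfl
    · intro q hq
      rw [dist_le_iff_dot hr hve, hvm]
      exact cap_of_extreme hr (sub_ne_zero.2 h₁.ne) (sub_ne_zero.2 h₂.ne.symm)
        ((dist_eq_iff' hr).1 h₁.dist_right) ((dist_eq_iff_dot hr h₁.dist_right).1 h₁.dist_left)
        (by linarith)
        ((dist_eq_iff' hr).1 h₂.dist_left) ((dist_eq_iff_dot hr h₂.dist_left).1 h₂.dist_right)
        h₂.cross_nonpos ((dist_le_iff_dot hr h₂.dist_left).1 (h₂.center u h₁.left_mem))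
        hmm (hle _ hu) (hle _ hw)
        ((dist_le_iff_dot hr h₂.dist_left).1 (h₂.center q hq))
        ((dist_le_iff_dot hr h₁.dist_right).1 (h₁.center q hq))
  exact ⟨⟨_, hK⟩, (mem_vertices_iff hr ⟨_, hK⟩).2 ⟨Or.inr h₁.right_mem, _, hK, hve⟩⟩

/-- If `p` and `v` are clockwise neighbors of each other, then their hull contains all points. -/
lemma InLens.of_arcs (hr : 0 < r) (h₁ : Arc r Q p v b) (h₂ : Arc r Q v p c) (hu : u ∈ Q)
    (hw : w ∈ Q) : InLens r u v w p := by
  have hP := dot_self_pos (sub_ne_zero.2 h₁.ne)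
  have eb := (dist_eq_iff_dot hr h₁.dist_right).1 h₁.dist_left
  have ec := (dist_eq_iff_dot hr h₂.dist_left).1 h₂.dist_right
  have nb := (dist_eq_iff' hr).1 h₁.dist_right
  have nc := (dist_eq_iff' hr).1 h₂.dist_left
  have xb := h₁.cross_nonpos
  rw [cross_sub_swap] at xb
  have xc := h₂.cross_nonpos
  -- The two centers are mirror images in the chord `v p`. Adding the two disk inequalities
  -- therefore gives the inequality of the disk with diameter `v p`.
  have hsum : (b - v) + (c - v) = p - v := by
    generalize b - v = B at *
    generalize c - v = C at *
    generalize p - v = P at *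
    have hx : cross P B = -cross P C := by
      have h1 : cross P B ^ 2 + dot B P ^ 2 = dot P P * dot B B := by unfold dot cross; ring
      have h2 : cross P C ^ 2 + dot C P ^ 2 = dot P P * dot C C := by unfold dot cross; ring
      have h3 : dot B P = dot C P := by linarith
      rw [h3, nb] at h1
      rw [nc] at h2
      have h4 : cross P B ^ 2 = (-cross P C) ^ 2 := by rw [neg_sq]; linarith
      exact (sq_eq_sq₀ (by linarith) (by linarith)).1 h4
    have e0 : dot P P * (B + C) 0 = dot P P * P 0 := by
      have : dot P P * (B + C) 0 =
          (dot B P + dot C P) * P 0 - (cross P B + cross P C) * P 1 := by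
        simp [dot, cross]; ring
      rw [this, hx]; linear_combination (P 0 / 2) * (eb + ec)
    have e1 : dot P P * (B + C) 1 = dot P P * P 1 := by
      have : dot P P * (B + C) 1 =
          (dot B P + dot C P) * P 1 + (cross P B + cross P C) * P 0 := by
        simp [dot, cross]; ring
      rw [this, hx]; linear_combination (P 1 / 2) * (eb + ec)
    exact plane_ext (mul_left_cancel₀ hP.ne' e0) (mul_left_cancel₀ hP.ne' e1)
  have hall : ∀ x ∈ Q, dot (x - v) (x - v) ≤ dot (p - v) (x - v) := by
    intro x hx
    have h1 := (dist_le_iff_dot hr h₁.dist_right).1 (h₁.center x hx)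
    have h2 := (dist_le_iff_dot hr h₂.dist_left).1 (h₂.center x hx)
    have : dot (p - v) (x - v) = dot (b - v) (x - v) + dot (c - v) (x - v) := by
      rw [← hsum]; simp [dot]; ring
    linarith
  exact ⟨dot_self_le_of_dot_le nb eb.symm.le, hall u hu, hall w hw⟩

end CircularHull

namespace CircularHull

/-! ### The cycle of the vertices -/

/-- `v 0, …, v k` are the vertices of the hull in clockwise order, starting with the rightmost
one, and `v (k + 1) = v 0`. -/
structure HullCycle (r : ℝ) (Q : Set Plane) (k : ℕ) (v : ℕ → Plane) : Prop where
  nonempty : (Centers r Q).Nonempty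
  closed : v (k + 1) = v 0
  inj : ∀ i ≤ k, ∀ j ≤ k, v i = v j → i = j
  mem_iff : ∀ q, q ∈ vertices r Q ↔ ∃ i ≤ k, v i = q
  arc : k ≠ 0 → ∀ i ≤ k, ∃ c, Arc r Q (v i) (v (i + 1)) c
  lt : ∀ i ≤ k, i ≠ 0 → v i 0 < v 0 0
  single : k = 0 → Q = {v 0}

namespace HullCycle

variable {r : ℝ} {Q : Set Plane} {k : ℕ} {v : ℕ → Plane} {p : Plane}

lemma mem (h : HullCycle r Q k v) {i : ℕ} (hi : i ≤ k) : v i ∈ Q :=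
  ((h.mem_iff (v i)).2 ⟨i, hi, rfl⟩).1

lemma mem' (h : HullCycle r Q k v) {i : ℕ} (hi : i ≤ k + 1) : v i ∈ Q := by
  rcases hi.lt_or_eq with hi | rfl
  · exact h.mem (by omega)
  · rw [h.closed]; exact h.mem (Nat.zero_le k)

lemma ne_zero_of_inDisk (h : HullCycle r Q k v) {i : ℕ} (hi : i ≤ k)
    (hd : InDisk r (v i) (v (i + 1)) p) : k ≠ 0 := by
  rintro rfl
  obtain rfl : i = 0 := by omega
  have := hd.1
  rw [h.closed] at this
  simp [dot] at this

/-- The predecessor of a vertex. -/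
lemma arc_pred (h : HullCycle r Q k v) (hk : k ≠ 0) {i : ℕ} (hi : i ≤ k) :
    ∃ i' ≤ k, ∃ c, Arc r Q (v i') (v i) c ∧ (i = 0 → i' = k) ∧ (i ≠ 0 → i' + 1 = i) ∧
      v (i' + 1) = v i := by
  rcases Nat.eq_zero_or_pos i with rfl | hi0
  · obtain ⟨c, hc⟩ := h.arc hk k le_rfl
    rw [h.closed] at hc
    exact ⟨k, le_rfl, c, hc, fun _ => rfl, fun h => absurd rfl h, h.closed⟩
  · obtain ⟨c, hc⟩ := h.arc hk (i - 1) (by omega)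
    have : i - 1 + 1 = i := by omega
    rw [this] at hc
    exact ⟨i - 1, by omega, c, hc, fun h0 => by omega, fun _ => this, by rw [this]⟩

/-- By `notMem_vertices_insert` the new point is not a vertex, so no center is lost. Hence all
vertices and all arcs remain, although only two arcs were tested. -/
lemma insert_of_inDisk (hr : 0 < r) (h : HullCycle r Q k v)
    (hQ : GeneralPosition r (insert p Q)) (hp : ∀ q ∈ Q, q 0 < p 0)
    (h₀ : InDisk r (v 0) (v 1) p) (h₁ : InDisk r (v k) (v (k + 1)) p) :
    HullCycle r (insert p Q) k v := by
  have hk := h.ne_zero_of_inDisk (Nat.zero_le k) h₀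
  obtain ⟨c, hc⟩ := h.arc hk 0 (Nat.zero_le k)
  obtain ⟨b, hb⟩ := h.arc hk k le_rfl
  rw [hc.inDisk_iff hr] at h₀
  rw [hb.inDisk_iff hr] at h₁
  have hb' := hb
  rw [h.closed] at hb'
  have hne : (Centers r (insert p Q)).Nonempty := ⟨c, (hc.insert h₀).center⟩
  have hnv := notMem_vertices_insert hr hQ hc hb' h₀ h₁ (h.lt 1 (by omega) (by omega))
    (h.lt k le_rfl hk) (hp _ (h.mem (Nat.zero_le k)))
  have hcen := centers_insert_of_notMem_vertices hr hne hnv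
  refine ⟨hne, h.closed, h.inj, fun q => ?_, fun hk i hi => ?_, h.lt, fun h0 => absurd h0 hk⟩
  · rw [← h.mem_iff]
    by_cases hqp : q = p
    · subst hqp
      refine iff_of_false hnv fun hq => (hp q hq.1).false
    · rw [mem_vertices_iff hr hne, mem_vertices_iff hr h.nonempty, hcen, Set.mem_insert_iff,
        or_iff_right hqp]
  · obtain ⟨d, hd⟩ := h.arc hk i hi
    refine ⟨d, hd.insert ?_⟩
    have := hd.center
    rw [← hcen] at this
    exact this p (Or.inl rfl)

/-- The new cycle that consists of the new point and of a segment of the old cycle. -/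
lemma insert_segment (hr : 0 < r) (h : HullCycle r Q k v) (hp : ∀ q ∈ Q, q 0 < p 0)
    {j m : ℕ} (hjm : j ≤ m) (hmk : m ≤ k + 1) (hj : j = 0 → m ≤ k)
    {e e' : Plane} (he : Arc r (insert p Q) p (v j) e) (he' : Arc r (insert p Q) (v m) p e')
    (hin : ∀ i, j ≤ i → i < m → InDisk r (v i) (v (i + 1)) p)
    (hall : ∀ i ≤ k, v i ∈ vertices r (insert p Q) → (j ≤ i ∧ i ≤ m) ∨ i = 0 ∧ m = k + 1)
    {v' : ℕ → Plane} (h0 : v' 0 = p) (hv' : ∀ i ≤ m - j, v' (i + 1) = v (j + i))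
    (hlast : v' (m - j + 2) = p) : HullCycle r (insert p Q) (m - j + 1) v' := by
  have harc : ∀ i ≤ m - j + 1, ∃ c, Arc r (insert p Q) (v' i) (v' (i + 1)) c := by
    intro i hi
    rcases Nat.eq_zero_or_pos i with rfl | hi0
    · rw [h0, hv' 0 (by omega)]
      exact ⟨e, he⟩
    · obtain ⟨i, rfl⟩ : ∃ i', i = i' + 1 := ⟨i - 1, by omega⟩
      rw [hv' i (by omega)]
      rcases (show i ≤ m - j by omega).lt_or_eq with hlt | rfl
      · rw [hv' (i + 1) (by omega)]
        have hd := hin (j + i) (by omega) (by omega)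
        obtain ⟨c, hc⟩ := h.arc (h.ne_zero_of_inDisk (by omega) hd) (j + i) (by omega)
        rw [hc.inDisk_iff hr] at hd
        exact ⟨c, hc.insert hd⟩
      · rw [hlast]
        have : j + (m - j) = m := by omega
        rw [this]
        exact ⟨e', he'⟩
  have hmemQ : ∀ i ≤ m - j, v' (i + 1) ∈ Q := by
    intro i hi
    rw [hv' i hi]
    exact h.mem' (by omega)
  refine ⟨⟨e, he.center⟩, by rw [hlast, h0], ?_, fun q => ⟨fun hq => ?_, ?_⟩, fun _ => harc, ?_,
    fun h0 => by omega⟩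
  · intro i hi i' hi' heq
    rcases Nat.eq_zero_or_pos i with rfl | hi0 <;> rcases Nat.eq_zero_or_pos i' with rfl | hi0'
    · rfl
    · obtain ⟨i', rfl⟩ : ∃ i'', i' = i'' + 1 := ⟨i' - 1, by omega⟩
      have := hp _ (hmemQ i' (by omega))
      rw [← heq, h0] at this
      exact absurd this (lt_irrefl _)
    · obtain ⟨i, rfl⟩ : ∃ i'', i = i'' + 1 := ⟨i - 1, by omega⟩
      have := hp _ (hmemQ i (by omega))
      rw [heq, h0] at this
      exact absurd this (lt_irrefl _)
    · obtain ⟨i, rfl⟩ : ∃ i'', i = i'' + 1 := ⟨i - 1, by omega⟩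
      obtain ⟨i', rfl⟩ : ∃ i'', i' = i'' + 1 := ⟨i' - 1, by omega⟩
      rw [hv' i (by omega), hv' i' (by omega)] at heq
      -- The index `k + 1` names `v 0` again; `hj` prevents both names from occurring in the
      -- segment.
      by_cases h1 : j + i = k + 1 <;> by_cases h2 : j + i' = k + 1
      · omega
      · rw [h1, h.closed] at heq
        have := h.inj 0 (Nat.zero_le k) _ (by omega) heq
        omega
      · rw [h2, h.closed] at heq
        have := h.inj _ (by omega) 0 (Nat.zero_le k) heq
        omega
      · have := h.inj _ (by omega) _ (by omega) heq
        omega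
  · rcases hq.1 with rfl | hqQ
    · exact ⟨0, by omega, h0⟩
    · have hq' : q ∈ vertices r Q := by
        have hK : (Centers r (insert p Q)).Nonempty := ⟨e, he.center⟩
        obtain ⟨-, c, hc, hqc⟩ := (mem_vertices_iff hr hK).1 hq
        exact (mem_vertices_iff hr h.nonempty).2
          ⟨hqQ, c, (mem_centers_insert.1 hc).2, hqc⟩
      obtain ⟨i, hi, rfl⟩ := (h.mem_iff q).1 hq'
      rcases hall i hi hq with ⟨h1, h2⟩ | ⟨rfl, rfl⟩
      · refine ⟨i - j + 1, by omega, ?_⟩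
        rw [hv' _ (by omega)]
        congr 1; omega
      · refine ⟨k + 1 - j + 1, le_rfl, ?_⟩
        rw [hv' _ le_rfl, ← h.closed]
        congr 1; omega
  · rintro ⟨i, hi, rfl⟩
    obtain ⟨c, hc⟩ := harc i hi
    exact hc.left_vertex hr
  · intro i hi hi0
    obtain ⟨i, rfl⟩ : ∃ i'', i = i'' + 1 := ⟨i - 1, by omega⟩
    rw [h0]
    exact hp _ (hmemQ i (by omega))

/-- Some arc survives: `j` is the first surviving one, and `m - 1` is the last. -/
lemma insert_of_found (hr : 0 < r) (h : HullCycle r Q k v)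
    (hQ : GeneralPosition r (insert p Q)) (hp : ∀ q ∈ Q, q 0 < p 0)
    {j m : ℕ} (hjm : j < m) (hmk : m ≤ k + 1) (hj : j = 0 → m ≤ k)
    (hjin : InDisk r (v j) (v (j + 1)) p) (hjout : ∀ i < j, ¬ InDisk r (v i) (v (i + 1)) p)
    (hmin : InDisk r (v (m - 1)) (v m) p)
    (hmout : ∀ i, m ≤ i → i ≤ k → ¬ InDisk r (v i) (v (i + 1)) p)
    {v' : ℕ → Plane} (h0 : v' 0 = p) (hv' : ∀ i ≤ m - j, v' (i + 1) = v (j + i))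
    (hlast : v' (m - j + 2) = p) : HullCycle r (insert p Q) (m - j + 1) v' := by
  have hk := h.ne_zero_of_inDisk (by omega) hjin
  have hm1 : m - 1 + 1 = m := by omega
  have harc : ∀ i ≤ k, InDisk r (v i) (v (i + 1)) p →
      ∃ c, Arc r (insert p Q) (v i) (v (i + 1)) c := by
    intro i hi hd
    obtain ⟨c, hc⟩ := h.arc hk i hi
    rw [hc.inDisk_iff hr] at hd
    exact ⟨c, hc.insert hd⟩
  obtain ⟨cj, hcj⟩ := harc j (by omega) hjin
  obtain ⟨cm, hcm⟩ := harc (m - 1) (by omega) (by rwa [hm1])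
  rw [hm1] at hcm
  have hK : (Centers r (insert p Q)).Nonempty := ⟨cj, hcj.center⟩
  have hpred : ∀ i ≤ k, ∀ i' ≤ k, v (i' + 1) = v i → ¬ InDisk r (v i') (v (i' + 1)) p →
      v i ∈ vertices r (insert p Q) → ∃ e, Arc r (insert p Q) p (v i) e := by
    intro i hi i' hi' hii hd hv
    obtain ⟨b, hb⟩ := h.arc hk i' hi'
    rw [hb.inDisk_iff hr] at hd
    rw [hii] at hb
    exact hb.insert_left hr hd hv hK
  obtain ⟨e, he⟩ : ∃ e, Arc r (insert p Q) p (v j) e := by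
    rcases Nat.eq_zero_or_pos j with rfl | hj0
    · exact hpred 0 (by omega) k le_rfl h.closed (hmout k (hj rfl) le_rfl) (hcj.left_vertex hr)
    · have : j - 1 + 1 = j := by omega
      exact hpred j (by omega) (j - 1) (by omega) (by rw [this]) (hjout _ (by omega))
        (hcj.left_vertex hr)
  -- A surviving vertex whose incoming arc is lost is the clockwise neighbor of `p`, and there is
  -- only one.
  have huniq : ∀ i ≤ k, ∀ i' ≤ k, v (i' + 1) = v i → ¬ InDisk r (v i') (v (i' + 1)) p →
      v i ∈ vertices r (insert p Q) → i = j := by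
    intro i hi i' hi' hii hd hv
    obtain ⟨e', he'⟩ := hpred i hi i' hi' hii hd hv
    exact h.inj i hi j (by omega) (he'.unique hr hQ he)
  obtain ⟨e', he'⟩ : ∃ e', Arc r (insert p Q) (v m) p e' := by
    have hmv := hcm.right_vertex hr
    obtain ⟨i, hi, him, hio⟩ : ∃ i ≤ k, v m = v i ∧ ¬ InDisk r (v i) (v (i + 1)) p := by
      rcases hmk.lt_or_eq with hlt | rfl
      · exact ⟨m, by omega, rfl, hmout m le_rfl (by omega)⟩
      · exact ⟨0, by omega, h.closed, hjout 0 (by omega)⟩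
    obtain ⟨b, hb⟩ := h.arc hk i hi
    rw [hb.inDisk_iff hr] at hio
    rw [him] at hmv ⊢
    exact hb.insert_right hr hio hmv hK
  refine h.insert_segment hr hp hjm.le hmk hj he he' ?_ ?_ h0 hv' hlast
  -- Descending from the last surviving arc: a lost arc followed by a surviving one would start a
  -- second run, whose first vertex would have to be `v j`.
  · intro i hji him
    obtain ⟨d, hd⟩ : ∃ d, i + d + 1 = m := ⟨m - 1 - i, by omega⟩
    induction d generalizing i with
    | zero =>
      obtain rfl : i = m - 1 := by omega
      rwa [hm1]
    | succ d ih =>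
      have h1 := ih (i + 1) (by omega) (by omega) (by omega)
      by_contra hcon
      obtain ⟨c, hc⟩ := harc (i + 1) (by omega) h1
      have := huniq (i + 1) (by omega) i (by omega) rfl hcon (hc.left_vertex hr)
      omega
  -- The incoming arc of a vertex outside the segment is lost, so its survival would identify it
  -- with `v j`.
  · intro i hi hiv
    by_contra! hcon
    rcases Nat.eq_zero_or_pos i with rfl | hi0
    · by_cases hm : m = k + 1
      · exact hcon.2 rfl hm
      · have := huniq 0 (by omega) k le_rfl h.closed (hmout k (by omega) le_rfl) hiv
        exact absurd (hcon.1 this.symm.le) (by omega)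
    · have hi1 : i - 1 + 1 = i := by omega
      have : i = j := by
        refine huniq i hi (i - 1) (by omega) (by rw [hi1]) ?_ hiv
        by_cases hij : i ≤ j
        · exact hjout _ (by omega)
        · exact hmout _ (by have := hcon.1 (by omega); omega) (by omega)
      have := hcon.1 this.symm.le
      omega

/-- No arc survives, but the vertex `v i` does. -/
lemma insert_of_inLens (hr : 0 < r) (h : HullCycle r Q k v)
    (hQ : GeneralPosition r (insert p Q)) (hp : ∀ q ∈ Q, q 0 < p 0)
    (hout : ∀ i ≤ k, ¬ InDisk r (v i) (v (i + 1)) p) {i : ℕ} (hi : i ≤ k) {u : Plane}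
    (hu0 : i = 0 → u = v k) (hu : i ≠ 0 → u = v (i - 1))
    (hl : InLens r u (v i) (v (i + 1)) p)
    {v' : ℕ → Plane} (h0 : v' 0 = p) (h1 : v' 1 = v i) (h2 : v' 2 = p) :
    HullCycle r (insert p Q) 1 v' := by
  have hpne : p ≠ v i := by
    intro h'
    have := hp _ (h.mem hi)
    rw [← h'] at this
    exact this.false
  have main : ∃ e e', Arc r (insert p Q) p (v i) e ∧ Arc r (insert p Q) (v i) p e' ∧
      ∀ i' ≤ k, v i' ∈ vertices r (insert p Q) → i' = i := by
    -- With a single vertex there are no arcs to turn from; `Q` is a point, and both arcs are given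
    -- directly by a center `e` and its mirror image `p - v 0 - e`, relative to `v 0`.
    by_cases hk : k = 0
    · obtain rfl : i = 0 := by omega
      have hQs := h.single hk
      obtain ⟨e, he, heP, hPe⟩ := exists_center (sub_ne_zero.2 hpne) hl.1
      have hQ' : ∀ c : Plane, dist p c = r → dist (v 0) c = r → c ∈ Centers r (insert p Q) := by
        intro c hpc hvc
        rw [mem_centers_insert, hQs]
        refine ⟨hpc.le, fun q hq => ?_⟩
        rw [Set.mem_singleton_iff.1 hq]
        exact hvc.le
      have hce : p - v 0 - e + v 0 - v 0 = p - v 0 - e := by abel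
      have hev : v 0 + e - v 0 = e := by abel
      have d1 : dist (v 0) (v 0 + e) = r := by rw [dist_eq_iff' hr, hev, he]
      have d2 : dist p (v 0 + e) = r := by rw [dist_eq_iff_dot hr d1, hev, heP]
      have d3 : dist (v 0) (p - v 0 - e + v 0) = r := by
        rw [dist_eq_iff' hr, hce, ← he]
        have : dot (p - v 0 - e) (p - v 0 - e) =
          dot (p - v 0) (p - v 0) - 2 * dot e (p - v 0) + dot e e := by simp [dot]; ring
        rw [this, heP]; ring
      have d4 : dist p (p - v 0 - e + v 0) = r := by
        rw [dist_eq_iff_dot hr d3, hce]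
        have : dot (p - v 0 - e) (p - v 0) = dot (p - v 0) (p - v 0) - dot e (p - v 0) := by
          simp [dot]; ring
        rw [this]; linarith
      have x4 : cross (p - v 0) (p - v 0 - e) = -cross (p - v 0) e := by simp [cross]; ring
      have hm0 : v 0 ∈ Q := h.mem hi
      refine ⟨v 0 + e, p - v 0 - e + v 0, ⟨Or.inl rfl, Or.inr hm0, hpne, hQ' _ d2 d1, d2, d1, ?_⟩,
        ⟨Or.inr hm0, Or.inl rfl, hpne.symm, hQ' _ d4 d3, d3, d4, ?_⟩, fun i' hi' _ => by omega⟩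
      · rw [cross_sub_swap, hev]; linarith
      · rw [hce, x4]; linarith
    · obtain ⟨i', hi', b, hb, hb0, hb1, hii⟩ := h.arc_pred hk hi
      have hub : v i' = u := by
        by_cases hi0 : i = 0
        · rw [hb0 hi0, hu0 hi0]
        · rw [hu hi0]; congr 1; have := hb1 hi0; omega
      obtain ⟨c, hc⟩ := h.arc hk i hi
      rw [← hub] at hl
      obtain ⟨hK, hv⟩ := hl.mem_vertices hr hpne hb hc
      have hbo := hout i' hi'
      rw [hii, hb.inDisk_iff hr] at hbo
      have hco := hout i hi
      rw [hc.inDisk_iff hr] at hco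
      obtain ⟨e, he⟩ := hb.insert_left hr hbo hv hK
      obtain ⟨e', he'⟩ := hc.insert_right hr hco hv hK
      refine ⟨e, e', he, he', fun l hl hlv => ?_⟩
      obtain ⟨l', hl', d, hd, -, -, hll⟩ := h.arc_pred hk hl
      have hdo := hout l' hl'
      rw [hll, hd.inDisk_iff hr] at hdo
      obtain ⟨d', hd'⟩ := hd.insert_left hr hdo hlv hK
      exact h.inj l hl i hi (hd'.unique hr hQ he)
  obtain ⟨e, e', he, he', huniq⟩ := main
  have := h.insert_segment hr hp (le_refl i) (by omega) (fun _ => hi) he he'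
    (fun l hl hl' => by omega) (fun l hl hlv => Or.inl ⟨(huniq l hl hlv).ge, (huniq l hl hlv).le⟩)
    h0 (fun l hl => by obtain rfl : l = 0 := by omega
                       simpa using h1) (by simpa using h2)
  simpa using this

/-- If no arc and no vertex survives, the hull ceases to exist. -/
lemma centers_insert_eq_empty (hr : 0 < r) (h : HullCycle r Q k v) (hfin : Q.Finite)
    (hp : ∀ q ∈ Q, q 0 < p 0)
    (hout : ∀ i ≤ k, ¬ InDisk r (v i) (v (i + 1)) p)
    (hl : ∀ i ≤ k, ∀ u, (i = 0 → u = v k) → (i ≠ 0 → u = v (i - 1)) →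
      ¬ InLens r u (v i) (v (i + 1)) p) : ¬ HullExists r (insert p Q) := by
  rw [hullExists_iff]
  intro hK
  have hm := h.mem (Nat.zero_le k)
  have hpne : p ≠ v 0 := by
    intro h'
    have := hp _ hm
    rw [← h'] at this
    exact this.false
  -- If a disk existed, some old vertex would survive. With both its arcs lost, it would be joined
  -- to `p` by arcs in both directions and pass the lens test; a lone vertex passes it by distance
  -- alone.
  obtain ⟨q, hqQ, hq⟩ := exists_vertex_insert hr hfin hm hpne hK
  have hq' : q ∈ vertices r Q := by
    obtain ⟨-, c, hc, hqc⟩ := (mem_vertices_iff hr hK).1 hq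
    exact (mem_vertices_iff hr h.nonempty).2 ⟨hqQ, c, (mem_centers_insert.1 hc).2, hqc⟩
  obtain ⟨i, hi, rfl⟩ := (h.mem_iff q).1 hq'
  by_cases hk : k = 0
  · subst hk
    obtain rfl : i = 0 := by omega
    obtain ⟨-, c, hc, hqc⟩ := (mem_vertices_iff hr hK).1 hq
    refine hl 0 le_rfl (v 0) (fun _ => rfl) (fun h => absurd rfl h) ⟨?_, ?_, ?_⟩
    · exact dot_self_le_of_dot_le ((dist_eq_iff' hr).1 hqc)
        ((dist_le_iff_dot hr hqc).1 (mem_centers_insert.1 hc).1)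
    · simp [dot]
    · rw [h.closed]; simp [dot]
  · obtain ⟨i', hi', b, hb, hb0, hb1, hii⟩ := h.arc_pred hk hi
    obtain ⟨c, hc⟩ := h.arc hk i hi
    have hbo := hout i' hi'
    rw [hii, hb.inDisk_iff hr] at hbo
    have hco := hout i hi
    rw [hc.inDisk_iff hr] at hco
    obtain ⟨e, he⟩ := hb.insert_left hr hbo hq hK
    obtain ⟨e', he'⟩ := hc.insert_right hr hco hq hK
    refine hl i hi (v i') (fun h0 => by rw [hb0 h0]) (fun h0 => ?_)
      (InLens.of_arcs hr he he' (Or.inr hb.left_mem) (Or.inr hc.right_mem))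
    congr 1; have := hb1 h0; omega

lemma singleton (hr : 0 < r) {v : ℕ → Plane} (h0 : v 0 = p) (h1 : v 1 = p) :
    HullCycle r {p} 0 v := by
  have hd : dist p (p + !₂[r, 0]) = r := by
    rw [dist_eq_iff' hr]
    simp [dot]; ring
  have hc : p + !₂[r, 0] ∈ Centers r {p} := by
    intro q hq
    rw [Set.mem_singleton_iff.1 hq]
    exact hd.le
  refine ⟨⟨_, hc⟩, by rw [h1, h0], fun i hi j hj _ => by omega, fun q => ?_,
    fun h => absurd rfl h, fun i hi h => by omega, fun _ => by rw [h0]⟩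
  rw [mem_vertices_iff hr ⟨_, hc⟩]
  constructor
  · rintro ⟨hq, -⟩
    exact ⟨0, le_rfl, by rw [h0, Set.mem_singleton_iff.1 hq]⟩
  · rintro ⟨i, hi, rfl⟩
    obtain rfl : i = 0 := by omega
    rw [h0]
    exact ⟨rfl, _, hc, hd⟩

end HullCycle

end CircularHull

namespace CircularHull

open RealRAM

/-! ### Geometric tests as expressions of the machine -/

/-- A pair of expressions for the coordinates of a vector. -/
abbrev VExpr : Type := RExpr × RExpr

noncomputable def evalV (σ : State) (u : VExpr) : Plane := !₂[u.1.eval σ, u.2.eval σ]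

def subV (u v : VExpr) : VExpr := (.sub u.1 v.1, .sub u.2 v.2)

def dotV (u v : VExpr) : RExpr := .add (.mul u.1 v.1) (.mul u.2 v.2)

def crossV (u v : VExpr) : RExpr := .sub (.mul u.1 v.2) (.mul u.2 v.1)

def nodeV (e : NExpr) : VExpr := (.load 0 e, .load 1 e)

def newV : VExpr := (.reg 1, .reg 2)

def leB (e f : RExpr) : BExpr := .not (.realLt f e)

/-- The point to be inserted. -/
noncomputable def newPoint (σ : State) : Plane := !₂[σ.rreg 1, σ.rreg 2]

lemma evalV_subV (σ : State) (u v : VExpr) : evalV σ (subV u v) = evalV σ u - evalV σ v := by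
  apply plane_ext <;> simp [evalV, subV, RExpr.eval]

lemma eval_dotV (σ : State) (u v : VExpr) :
    (dotV u v).eval σ = dot (evalV σ u) (evalV σ v) := by
  simp [evalV, dotV, dot, RExpr.eval]

lemma eval_crossV (σ : State) (u v : VExpr) :
    (crossV u v).eval σ = cross (evalV σ u) (evalV σ v) := by
  simp [evalV, crossV, cross, RExpr.eval]

lemma evalV_nodeV (σ : State) (e : NExpr) : evalV σ (nodeV e) = nodePoint σ (e.eval σ) := rfl

lemma evalV_newV (σ : State) : evalV σ newV = newPoint σ := rfl

lemma holds_leB (σ : State) (e f : RExpr) : (leB e f).holds σ ↔ e.eval σ ≤ f.eval σ := by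
  simp [leB, BExpr.holds]

/-- The test `InDisk` for the new point and the arc from node `e` to node `f`. -/
def inDiskB (e f : NExpr) : BExpr :=
  let W := subV (nodeV f) (nodeV e)
  let P := subV newV (nodeV e)
  let Y := RExpr.mul (dotV W W) (.sub (dotV P W) (dotV P P))
  let S := RExpr.mul (.mul (dotV W W)
    (.sub (.mul (.const 4) (.mul (.reg 0) (.reg 0))) (dotV W W)))
    (.mul (crossV W P) (crossV W P))
  .and (.realLt (.const 0) (dotV W W))
    (.or (.and (leB (crossV W P) (.const 0)) (leB (.const 0) Y))
      (.or (.and (leB (crossV W P) (.const 0)) (leB (.mul Y Y) S))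
        (.and (leB (.const 0) Y) (leB S (.mul Y Y)))))

lemma holds_inDiskB (σ : State) (e f : NExpr) : (inDiskB e f).holds σ ↔
    InDisk (σ.rreg 0) (nodePoint σ (e.eval σ)) (nodePoint σ (f.eval σ)) (newPoint σ) := by
  simp only [inDiskB, BExpr.holds, holds_leB, RExpr.eval, eval_dotV, eval_crossV, evalV_subV,
    evalV_nodeV, evalV_newV, InDisk, pow_two, Rat.cast_zero, Rat.cast_ofNat]

/-- The test `InLens` for the new point, the node `f`, and its neighbors `e` and `g`. -/
def inLensB (e f g : NExpr) : BExpr :=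
  let P := subV newV (nodeV f)
  let U := subV (nodeV e) (nodeV f)
  let W := subV (nodeV g) (nodeV f)
  .and (leB (dotV P P) (.mul (.const 4) (.mul (.reg 0) (.reg 0))))
    (.and (leB (dotV U U) (dotV P U)) (leB (dotV W W) (dotV P W)))

lemma holds_inLensB (σ : State) (e f g : NExpr) : (inLensB e f g).holds σ ↔
    InLens (σ.rreg 0) (nodePoint σ (e.eval σ)) (nodePoint σ (f.eval σ)) (nodePoint σ (g.eval σ))
      (newPoint σ) := by
  simp only [inLensB, BExpr.holds, holds_leB, RExpr.eval, eval_dotV, evalV_subV,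
    evalV_nodeV, evalV_newV, InLens, pow_two, Rat.cast_ofNat]

/-! ### Searching a circular list -/

/-- The memories differ in the auxiliary registers only. -/
structure SameMem (σ τ : State) : Prop where
  rreg : τ.rreg = σ.rreg
  narr : τ.narr = σ.narr
  rarr : τ.rarr = σ.rarr
  nreg : ∀ i, i ≠ 4 → i ≠ 5 → i ≠ 6 → τ.nreg i = σ.nreg i

namespace SameMem

variable {σ τ ρ : State}

lemma refl (σ : State) : SameMem σ σ := ⟨rfl, rfl, rfl, fun _ _ _ _ => rfl⟩

lemma trans (h : SameMem σ τ) (h' : SameMem τ ρ) : SameMem σ ρ :=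
  ⟨h'.rreg.trans h.rreg, h'.narr.trans h.narr, h'.rarr.trans h.rarr,
    fun i h4 h5 h6 => (h'.nreg i h4 h5 h6).trans (h.nreg i h4 h5 h6)⟩

lemma update (h : SameMem σ τ) {j : ℕ} (hj : j = 4 ∨ j = 5 ∨ j = 6) (x : ℕ) :
    SameMem σ { τ with nreg := Function.update τ.nreg j x } := by
  refine ⟨h.rreg, h.narr, h.rarr, fun i h4 h5 h6 => ?_⟩
  have : i ≠ j := by rintro rfl; omega
  simp only [Function.update_of_ne this]
  exact h.nreg i h4 h5 h6

lemma nodePoint (h : SameMem σ τ) (a : ℕ) : nodePoint τ a = nodePoint σ a := by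
  simp [CircularHull.nodePoint, h.rarr]

lemma newPoint (h : SameMem σ τ) : newPoint τ = newPoint σ := by
  simp [CircularHull.newPoint, h.rreg]

end SameMem

/-- One round of the search. -/
def searchBody (b : BExpr) (a : ℕ) : Cmd :=
  .ite b (.setNat 6 (.const 1))
    (.seq (.setNat 4 (.load a (.reg 4)))
      (.ite (.natEq (.reg 4) (.reg 0)) (.setNat 6 (.const 2)) .skip))

def searchLoop (b : BExpr) (a : ℕ) : Cmd := .loop (.natEq (.reg 6) (.const 0)) (searchBody b a)

/-- Starting from the node in register `0` and following the pointers in the array `a`, search for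
a node that satisfies the test `b`. Register `6` becomes `1` if there is such a node, and `2`
otherwise; register `4` becomes the first such node. -/
def search (b : BExpr) (a : ℕ) : Cmd :=
  .seq (.setNat 4 (.reg 0)) (.seq (.setNat 6 (.const 0)) (searchLoop b a))

lemma searchLoop_done {b : BExpr} {a : ℕ} {τ : State} (h : τ.nreg 6 ≠ 0) :
    Exec (searchLoop b a) τ 4 τ :=
  Exec.loopFalse (b := .natEq (.reg 6) (.const 0)) h

/-- Induction on the number `d` of nodes left after the current one. `T` is the test as a property
of the address in register `4`, the rest of the relevant memory being constant; `hne` ensures that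
the walk stops only after a full turn. -/
lemma exec_searchLoop {b : BExpr} {a : ℕ} {T : ℕ → Prop} {σ : State}
    (hT : ∀ τ, SameMem σ τ → (b.holds τ ↔ T (τ.nreg 4))) {w : ℕ → ℕ} {k : ℕ}
    (h0 : w 0 = σ.nreg 0) (hw : ∀ i ≤ k, σ.narr a (w i) = w (i + 1)) (hclosed : w (k + 1) = w 0)
    (hne : ∀ i ≤ k, i ≠ 0 → w i ≠ w 0) (d : ℕ) :
    ∀ s, s + d = k → ∀ τ, SameMem σ τ → τ.nreg 4 = w s → τ.nreg 6 = 0 →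
      ∃ ρ t, Exec (searchLoop b a) τ t ρ ∧ SameMem σ ρ ∧ ρ.nreg 5 = τ.nreg 5 ∧
        ((∃ s', s ≤ s' ∧ s' ≤ k ∧ T (w s') ∧ (∀ i, s ≤ i → i < s' → ¬ T (w i)) ∧
            ρ.nreg 4 = w s' ∧ ρ.nreg 6 = 1 ∧ t ≤ (b.cost + 20) * (s' - s + 1)) ∨
          ((∀ i, s ≤ i → i ≤ k → ¬ T (w i)) ∧ ρ.nreg 6 = 2 ∧
            t ≤ (b.cost + 20) * (k - s + 1))) := by
  induction d with
  | zero =>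
    intro s hs τ hτ h4 h6
    obtain rfl : s = k := by omega
    by_cases hb : T (w s)
    · have hb' : b.holds τ := (hT τ hτ).2 (by rwa [h4])
      refine ⟨_, _, Exec.loopTrue (by simpa [BExpr.holds, NExpr.eval] using h6)
        (Exec.iteTrue hb' (Exec.setNat _ _ _)) (searchLoop_done ?_),
        hτ.update (by simp) _, by simp, Or.inl ⟨s, le_rfl, le_rfl, hb, fun i _ _ => by omega,
          by simpa, by simp [NExpr.eval], ?_⟩⟩
      · simp [NExpr.eval]
      · simp [NExpr.cost, BExpr.cost]; omega
    · have hb' : ¬ b.holds τ := fun h => hb (by rw [← h4]; exact (hT τ hτ).1 h)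
      refine ⟨_, _, Exec.loopTrue (by simpa [BExpr.holds, NExpr.eval] using h6)
        (Exec.iteFalse hb' (Exec.seq (Exec.setNat _ _ _) (Exec.iteTrue ?_ (Exec.setNat _ _ _))))
        (searchLoop_done ?_), (hτ.update (by simp) _).update (by simp) _, by simp,
        Or.inr ⟨fun i h1 h2 => ?_, ?_, ?_⟩⟩
      · simp only [BExpr.holds, NExpr.eval, Function.update_self]
        rw [Function.update_of_ne (by decide), h4, hτ.narr, hw s le_rfl, hclosed, h0,
          hτ.nreg 0 (by decide) (by decide) (by decide)]
      · simp [NExpr.eval]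
      · obtain rfl : i = s := by omega
        exact hb
      · simp [NExpr.eval]
      · simp [NExpr.cost, BExpr.cost]; omega
  | succ d ih =>
    intro s hs τ hτ h4 h6
    by_cases hb : T (w s)
    · have hb' : b.holds τ := (hT τ hτ).2 (by rwa [h4])
      refine ⟨_, _, Exec.loopTrue (by simpa [BExpr.holds, NExpr.eval] using h6)
        (Exec.iteTrue hb' (Exec.setNat _ _ _)) (searchLoop_done ?_),
        hτ.update (by simp) _, by simp, Or.inl ⟨s, le_rfl, by omega, hb, fun i _ _ => by omega,
          by simpa, by simp [NExpr.eval], ?_⟩⟩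
      · simp [NExpr.eval]
      · simp [NExpr.cost, BExpr.cost]; omega
    · have hb' : ¬ b.holds τ := fun h => hb (by rw [← h4]; exact (hT τ hτ).1 h)
      have hτ' := hτ.update (j := 4) (by simp) (τ.narr a (τ.nreg 4))
      obtain ⟨ρ, t, hex, hρ, h5, hres⟩ := ih (s + 1) (by omega) _ hτ'
        (by simp only [Function.update_self]; rw [h4, hτ.narr, hw s (by omega)])
        (by simpa using h6)
      refine ⟨ρ, _, Exec.loopTrue (by simpa [BExpr.holds, NExpr.eval] using h6)
        (Exec.iteFalse hb' (Exec.seq (Exec.setNat _ _ _) (Exec.iteFalse ?_ (Exec.skip _))))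
        hex, hρ, by simpa using h5, ?_⟩
      · simp only [BExpr.holds, NExpr.eval, Function.update_self]
        rw [Function.update_of_ne (by decide), h4, hτ.narr, hw s (by omega),
          hτ.nreg 0 (by decide) (by decide) (by decide), ← h0]
        exact hne _ (by omega) (by omega)
      · have hall : ∀ i, s ≤ i → ¬ s + 1 ≤ i → ¬ T (w i) := by
          intro i h1 h2
          obtain rfl : i = s := by omega
          exact hb
        rcases hres with ⟨s', h1, h2, h3, h4, h5, h6, h7⟩ | ⟨h1, h2, h3⟩
        · refine Or.inl ⟨s', by omega, h2, h3, fun i hi hi' => ?_, h5, h6, ?_⟩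
          · by_cases h : s + 1 ≤ i
            · exact h4 i h hi'
            · exact hall i hi h
          · have : s' - s + 1 = (s' - (s + 1) + 1) + 1 := by omega
            rw [this, mul_add]
            simp only [NExpr.cost, BExpr.cost]; omega
        · refine Or.inr ⟨fun i hi hi' => ?_, h2, ?_⟩
          · by_cases h : s + 1 ≤ i
            · exact h1 i h hi'
            · exact hall i hi h
          · have : k - s + 1 = (k - (s + 1) + 1) + 1 := by omega
            rw [this, mul_add]
            simp only [NExpr.cost, BExpr.cost]; omega

lemma exec_search {b : BExpr} {a : ℕ} {T : ℕ → Prop} {σ : State}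
    (hT : ∀ τ, SameMem σ τ → (b.holds τ ↔ T (τ.nreg 4))) {w : ℕ → ℕ} {k : ℕ}
    (h0 : w 0 = σ.nreg 0) (hw : ∀ i ≤ k, σ.narr a (w i) = w (i + 1)) (hclosed : w (k + 1) = w 0)
    (hne : ∀ i ≤ k, i ≠ 0 → w i ≠ w 0) :
    ∃ ρ t, Exec (search b a) σ t ρ ∧ SameMem σ ρ ∧ ρ.nreg 5 = σ.nreg 5 ∧
      ((∃ s ≤ k, T (w s) ∧ (∀ i < s, ¬ T (w i)) ∧ ρ.nreg 4 = w s ∧ ρ.nreg 6 = 1 ∧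
          t ≤ (b.cost + 20) * (s + 2)) ∨
        ((∀ i ≤ k, ¬ T (w i)) ∧ ρ.nreg 6 = 2 ∧ t ≤ (b.cost + 20) * (k + 2))) := by
  have hτ := ((SameMem.refl σ).update (j := 4) (by simp) (σ.nreg 0)).update (j := 6) (by simp) 0
  obtain ⟨ρ, t, hex, hρ, h5, hres⟩ := exec_searchLoop hT h0 hw hclosed hne k 0 (by omega) _ hτ
    (by simpa using h0.symm) (by simp)
  refine ⟨ρ, _, Exec.seq (Exec.setNat _ _ _) (Exec.seq (Exec.setNat _ _ _) hex), hρ,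
    by simpa using h5, ?_⟩
  rcases hres with ⟨s', -, h2, h3, h4, h5, h6, h7⟩ | ⟨h1, h2, h3⟩
  · refine Or.inl ⟨s', h2, h3, fun i hi => h4 i (Nat.zero_le i) hi, h5, h6, ?_⟩
    have : s' + 2 = (s' - 0 + 1) + 1 := by omega
    rw [this, mul_add]
    simp only [NExpr.cost]; omega
  · refine Or.inr ⟨fun i hi => h1 i (Nat.zero_le i) hi, h2, ?_⟩
    have : k + 2 = (k - 0 + 1) + 1 := by omega
    rw [this, mul_add]
    simp only [NExpr.cost]; omega

end CircularHull

namespace CircularHull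

open RealRAM

/-! ### The insertion program -/

/-- Put the node in register `3` between the nodes in the registers `5` and `4`, in clockwise
order, and make it the rightmost vertex. -/
def link : Cmd :=
  .seq (.storeNat 0 (.reg 3) (.reg 4)) (.seq (.storeNat 1 (.reg 4) (.reg 3))
    (.seq (.storeNat 1 (.reg 3) (.reg 5)) (.seq (.storeNat 0 (.reg 5) (.reg 3))
      (.setNat 0 (.reg 3)))))

lemma exec_link {τ : State} {a y z : ℕ} (h3 : τ.nreg 3 = a) (h4 : τ.nreg 4 = z)
    (h5 : τ.nreg 5 = y) :
    ∃ ρ t, Exec link τ t ρ ∧ t ≤ 30 ∧ ρ.rreg = τ.rreg ∧ ρ.rarr = τ.rarr ∧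
      ρ.nreg = Function.update τ.nreg 0 a ∧
      ρ.narr 0 = Function.update (Function.update (τ.narr 0) a z) y a ∧
      ρ.narr 1 = Function.update (Function.update (τ.narr 1) z a) a y := by
  subst h3 h4 h5
  refine ⟨_, _, Exec.seq (Exec.storeNat _ _ _ _) (Exec.seq (Exec.storeNat _ _ _ _)
    (Exec.seq (Exec.storeNat _ _ _ _) (Exec.seq (Exec.storeNat _ _ _ _) (Exec.setNat _ _ _)))),
    ?_, rfl, rfl, rfl, ?_, ?_⟩
  · simp [NExpr.cost]
  · simp [State.writeNat, NExpr.eval]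
  · simp [State.writeNat, NExpr.eval]

/-- The arc that ends in the node in register `4` survives. -/
def testBackward : BExpr := inDiskB (.load 1 (.reg 4)) (.reg 4)

/-- The arc that starts in the node in register `4` survives. -/
def testForward : BExpr := inDiskB (.reg 4) (.load 0 (.reg 4))

/-- The node in register `4` survives, if no arc does. -/
def testLens : BExpr := inLensB (.load 1 (.reg 4)) (.reg 4) (.load 0 (.reg 4))

/-- The new point lies in the disks of both arcs at the rightmost vertex. -/
def testInside : BExpr :=
  .and (inDiskB (.reg 0) (.load 0 (.reg 0))) (inDiskB (.load 1 (.reg 0)) (.reg 0))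

/-- Find the clockwise neighbor (register `4`) and the counterclockwise neighbor (register `5`) of
the new vertex; register `6` becomes `1` if they exist. -/
def findNeighbors : Cmd :=
  .seq (search testBackward 1) (.seq (.setNat 5 (.reg 4))
    (.ite (.natEq (.reg 6) (.const 1)) (search testForward 0)
      (.seq (search testLens 0) (.setNat 5 (.reg 4)))))

def update : Cmd :=
  .seq findNeighbors (.ite (.natEq (.reg 6) (.const 1)) link (.setNat 1 (.const 0)))

/-- The list with the node in register `3` only. -/
def startList : Cmd :=
  .seq (.storeNat 0 (.reg 3) (.reg 3)) (.seq (.storeNat 1 (.reg 3) (.reg 3)) (.setNat 0 (.reg 3)))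

def insertCore : Cmd :=
  .ite (.natEq (.reg 1) (.const 0)) .skip
    (.ite (.natEq (.reg 3) (.const 0)) startList (.ite testInside .skip update))

def insertCmd : Cmd :=
  .seq (.storeReal 0 (.reg 3) (.reg 1)) (.seq (.storeReal 1 (.reg 3) (.reg 2))
    (.seq insertCore (.setNat 3 (.succ (.reg 3)))))

/-- The memory holds the cycle of the vertices at the addresses `v 0, …, v k`, all below `N`. -/
structure Stores (r : ℝ) (Q : Set Plane) (N : ℕ) (σ : State) (k : ℕ) (v : ℕ → ℕ) : Prop where
  cycle : HullCycle r Q k fun i => nodePoint σ (v i)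
  closed : v (k + 1) = v 0
  lt : ∀ i, v i < N
  right : σ.nreg 0 = v 0
  cw : ∀ i ≤ k, σ.narr 0 (v i) = v (i + 1)
  ccw : ∀ i ≤ k, σ.narr 1 (v (i + 1)) = v i

/-- The bound on the cost of a round of a search. -/
def roundCost : ℕ := testBackward.cost + testForward.cost + testLens.cost + 20

/-- The addresses of the nodes after the insertion of `N` in front of `v j, …, v (j + d)`. -/
def newNodes (v : ℕ → ℕ) (N j d : ℕ) (i : ℕ) : ℕ :=
  if i = 0 ∨ d + 1 < i then N else v (j + (i - 1))

lemma newNodes_zero (v : ℕ → ℕ) (N j d : ℕ) : newNodes v N j d 0 = N := by simp [newNodes]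

lemma newNodes_succ (v : ℕ → ℕ) (N j : ℕ) {d i : ℕ} (hi : i ≤ d) :
    newNodes v N j d (i + 1) = v (j + i) := by
  simp [newNodes, hi]

lemma newNodes_last (v : ℕ → ℕ) (N j d : ℕ) : newNodes v N j d (d + 2) = N := by
  simp [newNodes]

/-! ### Potential: twice the cost of a round for each vertex -/

/-- Exactly `s + j` arcs are lost, and the two searches stop after passing them, so the drop of the
potential pays for all but constantly many rounds. -/
lemma search_cost_found {A s j d k t₁ t₂ t c : ℕ} (h₁ : t₁ ≤ A * (s + 2)) (h₂ : t₂ ≤ A * (j + 2))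
    (hk : k + 1 = s + j + d) (ht : t = t₁ + t₂ + c) (hc : c ≤ 20) :
    t + 2 * A * (d + 2) ≤ 2 * A * (k + 1) + (8 * A + 20) := by
  rw [hk]
  nlinarith [Nat.zero_le (A * s), Nat.zero_le (A * j)]

/-- Two full turns are made, but at most two vertices remain. This case is what requires the factor
two in the potential. -/
lemma search_cost_lens {A k t₁ t₂ t c : ℕ} (h₁ : t₁ ≤ A * (k + 2)) (h₂ : t₂ ≤ A * (k + 2))
    (ht : t = t₁ + t₂ + c) (hc : c ≤ 20) :
    t + 2 * A * (0 + 2) ≤ 2 * A * (k + 1) + (8 * A + 20) := by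
  nlinarith

namespace Stores

variable {r : ℝ} {Q : Set Plane} {N : ℕ} {σ τ : State} {k : ℕ} {v : ℕ → ℕ} {p : Plane}

lemma inj (h : Stores r Q N σ k v) {i j : ℕ} (hi : i ≤ k) (hj : j ≤ k) (hij : v i = v j) :
    i = j := h.cycle.inj i hi j hj (by simp only [hij])

lemma ne_first (h : Stores r Q N σ k v) {i : ℕ} (hi : i ≤ k) (hi0 : i ≠ 0) : v i ≠ v 0 :=
  fun h' => hi0 (h.inj hi (Nat.zero_le k) h')

lemma ccw_zero (h : Stores r Q N σ k v) : σ.narr 1 (v 0) = v k := by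
  rw [← h.closed]; exact h.ccw k le_rfl

lemma ccw_of_ne_zero (h : Stores r Q N σ k v) {i : ℕ} (hi : i ≤ k) (hi0 : i ≠ 0) :
    σ.narr 1 (v i) = v (i - 1) := by
  have := h.ccw (i - 1) (by omega)
  rwa [show i - 1 + 1 = i by omega] at this

/-- The effect of `link` on the stored cycle. -/
lemma of_link (h : Stores r Q N σ k v) (hτ : SameMem σ τ) {ρ : State} {j d : ℕ}
    (hjd : j + d ≤ k + 1) (hj : j = 0 → d ≤ k)
    (hρ : ρ.rarr = τ.rarr) (hρn : ρ.nreg = Function.update τ.nreg 0 N)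
    (hρ0 : ρ.narr 0 = Function.update (Function.update (τ.narr 0) N (v j)) (v (j + d)) N)
    (hρ1 : ρ.narr 1 = Function.update (Function.update (τ.narr 1) (v j) N) N (v (j + d)))
    {Q' : Set Plane}
    (hc : HullCycle r Q' (d + 1) fun i => nodePoint σ (newNodes v N j d i)) :
    Stores r Q' (N + 1) ρ (d + 1) (newNodes v N j d) := by
  have hpt : ∀ a, nodePoint ρ a = nodePoint σ a := by
    intro a; simp [nodePoint, hρ, hτ.rarr]
  have hvN : ∀ i, v i ≠ N := fun i => (h.lt i).ne
  -- The retained nodes are distinct, so redirecting the pointers at the two ends leaves those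
  -- between them intact. For `d = 0` both ends are the same node.
  have hinj : ∀ i i', j ≤ i → i < i' → i' ≤ j + d → v i ≠ v i' := by
    intro i i' h1 h2 h3 heq
    rcases (show i' ≤ k + 1 by omega).lt_or_eq with hlt | rfl
    · have := h.inj (by omega) (by omega) heq; omega
    · rw [h.closed] at heq
      have := h.inj (by omega) (Nat.zero_le k) heq
      omega
  refine ⟨by simpa only [hpt] using hc, ?_, fun i => ?_, ?_, fun i hi => ?_, fun i hi => ?_⟩
  · rw [newNodes_last, newNodes_zero]
  -- Outside the cycle `newNodes` has the value `N`, so the bound on the addresses holds for every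
  -- index.
  · unfold newNodes
    split_ifs
    · omega
    · have := h.lt (j + (i - 1)); omega
  · rw [hρn, newNodes_zero, Function.update_self]
  · rw [hρ0, hτ.narr]
    rcases Nat.eq_zero_or_pos i with rfl | hi0
    · rw [newNodes_zero, newNodes_succ _ _ _ (Nat.zero_le d),
        Function.update_of_ne (hvN _).symm, Function.update_self, add_zero]
    · obtain ⟨i, rfl⟩ : ∃ i', i = i' + 1 := ⟨i - 1, by omega⟩
      rw [newNodes_succ _ _ _ (by omega)]
      rcases (show i ≤ d by omega).lt_or_eq with hlt | rfl
      · rw [newNodes_succ _ _ _ (by omega),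
          Function.update_of_ne (hinj _ _ (by omega) (by omega) le_rfl),
          Function.update_of_ne (hvN _), h.cw _ (by omega)]
        rfl
      · rw [newNodes_last, Function.update_self]
  · rw [hρ1, hτ.narr]
    rcases Nat.eq_zero_or_pos i with rfl | hi0
    · rw [newNodes_zero, newNodes_succ _ _ _ (Nat.zero_le d), add_zero,
        Function.update_of_ne (hvN _), Function.update_self]
    · obtain ⟨i, rfl⟩ : ∃ i', i = i' + 1 := ⟨i - 1, by omega⟩
      rw [newNodes_succ _ _ _ (show i ≤ d by omega)]
      rcases (show i ≤ d by omega).lt_or_eq with hlt | rfl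
      · rw [newNodes_succ _ _ _ (show i + 1 ≤ d by omega), Function.update_of_ne (hvN _),
          Function.update_of_ne (hinj _ _ le_rfl (by omega) (by omega)).symm]
        exact h.ccw (j + i) (by omega)
      · rw [newNodes_last, Function.update_self]

/-- The outcome of the search for the neighbors of the new vertex. -/
lemma exec_findNeighbors (hr : 0 < r) (h : Stores r Q N σ k v) (hfin : Q.Finite)
    (hQ : GeneralPosition r (insert p Q)) (hp : ∀ q ∈ Q, q 0 < p 0) (hr0 : σ.rreg 0 = r)
    (hN : nodePoint σ N = p) (hnew : newPoint σ = p) (hin : ¬ testInside.holds σ) :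
    ∃ ρ t, Exec findNeighbors σ t ρ ∧ SameMem σ ρ ∧
      ((∃ j d, j + d ≤ k + 1 ∧ (j = 0 → d ≤ k) ∧ ρ.nreg 4 = v j ∧ ρ.nreg 5 = v (j + d) ∧
          ρ.nreg 6 = 1 ∧
          HullCycle r (insert p Q) (d + 1) (fun i => nodePoint σ (newNodes v N j d i)) ∧
          t + 2 * roundCost * (d + 2) ≤ 2 * roundCost * (k + 1) + (8 * roundCost + 20)) ∨
        (ρ.nreg 6 ≠ 1 ∧ ¬ HullExists r (insert p Q) ∧
          t ≤ 2 * roundCost * (k + 1) + (8 * roundCost + 20))) := by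
  set T : ℕ → Prop := fun a => InDisk r (nodePoint σ (σ.narr 1 a)) (nodePoint σ a) p with hT
  set T' : ℕ → Prop := fun a => InDisk r (nodePoint σ a) (nodePoint σ (σ.narr 0 a)) p with hT'
  set T'' : ℕ → Prop := fun a => InLens r (nodePoint σ (σ.narr 1 a)) (nodePoint σ a)
    (nodePoint σ (σ.narr 0 a)) p with hT''
  have hb : ∀ τ, SameMem σ τ → (testBackward.holds τ ↔ T (τ.nreg 4)) := by
    intro τ hτ
    simp only [testBackward, holds_inDiskB, NExpr.eval, hτ.nodePoint, hτ.newPoint, hτ.narr,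
      hτ.rreg, hr0, hnew, hT]
  have hf : ∀ τ, SameMem σ τ → (testForward.holds τ ↔ T' (τ.nreg 4)) := by
    intro τ hτ
    simp only [testForward, holds_inDiskB, NExpr.eval, hτ.nodePoint, hτ.newPoint, hτ.narr,
      hτ.rreg, hr0, hnew, hT']
  have hl : ∀ τ, SameMem σ τ → (testLens.holds τ ↔ T'' (τ.nreg 4)) := by
    intro τ hτ
    simp only [testLens, holds_inLensB, NExpr.eval, hτ.nodePoint, hτ.newPoint, hτ.narr,
      hτ.rreg, hr0, hnew, hT'']
  have hTi : ∀ i ≤ k, (T (v (i + 1)) ↔ InDisk r (nodePoint σ (v i)) (nodePoint σ (v (i + 1))) p) := by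
    intro i hi
    simp only [hT, h.ccw i hi]
  have hT'i : ∀ i ≤ k, (T' (v i) ↔ InDisk r (nodePoint σ (v i)) (nodePoint σ (v (i + 1))) p) := by
    intro i hi
    simp only [hT', h.cw i hi]
  have hA : testBackward.cost + 20 ≤ roundCost ∧ testForward.cost + 20 ≤ roundCost ∧
      testLens.cost + 20 ≤ roundCost := by
    unfold roundCost
    omega
  -- The backward search visits `v (k + 1) = v 0`, `v k`, and so on; at `v (i + 1)` it tests the arc
  -- with index `i`.
  obtain ⟨ρ₁, t₁, hex₁, hρ₁, -, hres₁⟩ := exec_search hb (w := fun s => v (k + 1 - s)) (k := k)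
    (by simp [h.closed, h.right])
    (fun i hi => by
      have := h.ccw (k - i) (by omega)
      rw [show k - i + 1 = k + 1 - i by omega] at this
      simpa [show k + 1 - (i + 1) = k - i by omega] using this)
    (by simp [h.closed])
    (fun i hi hi0 => by
      have := h.ne_first (i := k + 1 - i) (by omega) (by omega)
      simpa [h.closed] using this)
  set ρ₂ : State := { ρ₁ with nreg := Function.update ρ₁.nreg 5 (ρ₁.nreg 4) } with hρ₂def
  have hρ₂ : SameMem σ ρ₂ := hρ₁.update (by simp) _
  have hfwd := exec_search (σ := ρ₂) (fun τ hτ => hf τ (hρ₂.trans hτ)) (w := v) (k := k)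
    (by rw [hρ₂.nreg 0 (by decide) (by decide) (by decide), h.right])
    (fun i hi => by rw [hρ₂.narr]; exact h.cw i hi) h.closed
    (fun i hi hi0 => h.ne_first hi hi0)
  have hlns := exec_search (σ := ρ₂) (fun τ hτ => hl τ (hρ₂.trans hτ)) (w := v) (k := k)
    (by rw [hρ₂.nreg 0 (by decide) (by decide) (by decide), h.right])
    (fun i hi => by rw [hρ₂.narr]; exact h.cw i hi) h.closed
    (fun i hi hi0 => h.ne_first hi hi0)
  have h55 : ρ₂.nreg 5 = ρ₁.nreg 4 := by simp [hρ₂def]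
  rcases hres₁ with ⟨s, hsk, hs, hsmin, hs4, hs6, hst⟩ | ⟨hall, hs6, hst⟩
  · obtain ⟨ρ₃, t₃, hex₃, hρ₃, h35, hres₃⟩ := hfwd
    refine ⟨ρ₃, _, Exec.seq hex₁ (Exec.seq (Exec.setNat _ _ _) (Exec.iteTrue ?_ hex₃)),
      hρ₂.trans hρ₃, Or.inl ?_⟩
    · simpa [BExpr.holds, NExpr.eval] using hs6
    · have hms : InDisk r (nodePoint σ (v (k - s))) (nodePoint σ (v (k - s + 1))) p := by
        rw [← hTi _ (by omega), show k - s + 1 = k + 1 - s by omega]; exact hs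
      have hmout : ∀ i, k + 1 - s ≤ i → i ≤ k →
          ¬ InDisk r (nodePoint σ (v i)) (nodePoint σ (v (i + 1))) p := by
        intro i h1 h2
        rw [← hTi i h2]
        have := hsmin (k - i) (by omega)
        simpa [show k + 1 - (k - i) = i + 1 by omega] using this
      -- The forward search cannot fail, because it would meet the arc found by the backward one.
      rcases hres₃ with ⟨j, hjk, hj, hjmin, hj4, hj6, hjt⟩ | ⟨hall, -, -⟩
      swap
      · exact absurd ((hT'i _ (by omega)).2 hms) (hall (k - s) (by omega))
      have hjm : j < k + 1 - s := by
        by_contra! hcon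
        exact hmout j hcon hjk ((hT'i j hjk).1 hj)
      have hjmin' : ∀ i < j, ¬ InDisk r (nodePoint σ (v i)) (nodePoint σ (v (i + 1))) p := by
        intro i hi
        rw [← hT'i i (by omega)]
        exact hjmin i hi
      -- Otherwise both arcs at the rightmost vertex survive, which `testInside` has excluded.
      have hj0 : j = 0 → k + 1 - s ≤ k := by
        rintro rfl
        by_contra! hcon
        obtain rfl : s = 0 := by omega
        apply hin
        simp only [testInside, BExpr.holds, holds_inDiskB, NExpr.eval, hr0, hnew, h.right]
        exact ⟨hj, by simpa [hT, h.closed] using hs⟩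
      obtain ⟨d, hd⟩ : ∃ d, k + 1 - s = j + d := ⟨k + 1 - s - j, by omega⟩
      rw [hd] at hjm hj0 hmout
      refine ⟨j, d, by omega, fun h0 => by have := hj0 h0; omega, hj4, ?_, hj6, ?_, ?_⟩
      · rw [h35, h55, hs4, hd]
      · have := h.cycle.insert_of_found hr hQ hp hjm (by omega) hj0 ((hT'i j hjk).1 hj) hjmin'
          (by
            rw [show j + d - 1 = k - s by omega, show j + d = k - s + 1 by omega]
            exact hms) hmout
          (v' := fun i => nodePoint σ (newNodes v N j d i))
          (by rw [newNodes_zero, hN])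
          (fun i hi => by rw [newNodes_succ _ _ _ (by omega)])
          (by rw [show j + d - j + 2 = d + 2 by omega, newNodes_last, hN])
        rwa [show j + d - j = d by omega] at this
      · have h1 : t₁ ≤ roundCost * (s + 2) := hst.trans (Nat.mul_le_mul_right _ hA.1)
        have h2 : t₃ ≤ roundCost * (j + 2) := hjt.trans (Nat.mul_le_mul_right _ hA.2.1)
        have h3 : k + 1 = s + j + d := by omega
        exact search_cost_found h1 h2 h3 (c := 6) (by simp only [NExpr.cost, BExpr.cost]; omega)
          (by omega)
  · have hout : ∀ i ≤ k, ¬ InDisk r (nodePoint σ (v i)) (nodePoint σ (v (i + 1))) p := by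
      intro i hi
      rw [← hTi i hi]
      have := hall (k - i) (by omega)
      simpa [show k + 1 - (k - i) = i + 1 by omega] using this
    obtain ⟨ρ₃, t₃, hex₃, hρ₃, h35, hres₃⟩ := hlns
    refine ⟨_, _, Exec.seq hex₁ (Exec.seq (Exec.setNat _ _ _)
      (Exec.iteFalse ?_ (Exec.seq hex₃ (Exec.setNat _ _ _)))),
      (hρ₂.trans hρ₃).update (by simp) _, ?_⟩
    · simp [BExpr.holds, NExpr.eval, hs6]
    · have h1 : t₁ ≤ roundCost * (k + 2) := hst.trans (Nat.mul_le_mul_right _ hA.1)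
      rcases hres₃ with ⟨j, hjk, hj, hjmin, hj4, hj6, hjt⟩ | ⟨hall', hj6, hjt⟩
      · refine Or.inl ⟨j, 0, by omega, fun _ => Nat.zero_le k, by simpa using hj4,
          by simpa [NExpr.eval] using hj4, by simpa using hj6, ?_, ?_⟩
        · refine h.cycle.insert_of_inLens hr hQ hp hout hjk (u := nodePoint σ (σ.narr 1 (v j)))
            (fun h0 => by rw [h0, h.ccw_zero]) (fun h0 => by rw [h.ccw_of_ne_zero hjk h0]) ?_
            (by rw [newNodes_zero, hN]) (by rw [newNodes_succ _ _ _ le_rfl]; rfl)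
            (by rw [newNodes_last, hN])
          have := hj
          simp only [hT'', h.cw j hjk] at this
          exact this
        · have h2 : t₃ ≤ roundCost * (k + 2) :=
            hjt.trans (Nat.mul_le_mul hA.2.2 (by omega))
          exact search_cost_lens h1 h2 (c := 8) (by simp only [NExpr.cost, BExpr.cost]; omega)
            (by omega)
      · refine Or.inr ⟨by simp [hj6], ?_, ?_⟩
        · refine h.cycle.centers_insert_eq_empty hr hfin hp hout fun i hi u hu0 hu hl => ?_
          apply hall' i hi
          have hu' : nodePoint σ (σ.narr 1 (v i)) = u := by
            by_cases h0 : i = 0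
            · rw [hu0 h0, h0, h.ccw_zero]
            · rw [hu h0, h.ccw_of_ne_zero hi h0]
          simp only [hT'', h.cw i hi, hu']
          exact hl
        · have h2 : t₃ ≤ roundCost * (k + 2) := hjt.trans (Nat.mul_le_mul_right _ hA.2.2)
          exact (Nat.le_add_right _ _).trans (search_cost_lens h1 h2 (c := 8)
            (by simp only [NExpr.cost, BExpr.cost]; omega) (by omega))

end Stores

end CircularHull

namespace CircularHull

open RealRAM

/-! ### Correctness and cost of an insertion -/

/-- The memory after `N` insertions, where `Q` is the set of the inserted points; `Φ` is the
number of vertices, and is used as a potential. -/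
def Maintained (r : ℝ) (Q : Set Plane) (N Φ : ℕ) (σ : State) : Prop :=
  σ.rreg 0 = r ∧ σ.nreg 3 = N ∧
    ((N = 0 ∧ Q = ∅ ∧ σ.nreg 1 = 1 ∧ Φ = 0) ∨
      (N ≠ 0 ∧ σ.nreg 1 = 1 ∧ ∃ k v, Stores r Q N σ k v ∧ Φ = k + 1) ∨
      (N ≠ 0 ∧ σ.nreg 1 = 0 ∧ ¬ HullExists r Q ∧ Φ = 0))

def insertCost : ℕ := testInside.cost + 8 * roundCost + 100

lemma Stores.congr {r : ℝ} {Q : Set Plane} {N : ℕ} {σ τ : State} {k : ℕ} {v : ℕ → ℕ}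
    (h : Stores r Q N σ k v) (hp : ∀ a < N, nodePoint τ a = nodePoint σ a)
    (h0 : τ.narr 0 = σ.narr 0) (h1 : τ.narr 1 = σ.narr 1) (hr : τ.nreg 0 = σ.nreg 0) :
    Stores r Q N τ k v := by
  refine ⟨?_, h.closed, h.lt, hr.trans h.right, fun i hi => by rw [h0]; exact h.cw i hi,
    fun i hi => by rw [h1]; exact h.ccw i hi⟩
  have := h.cycle
  simp only [fun i => (hp (v i) (h.lt i)).symm] at this
  exact this

variable {r : ℝ} {Q : Set Plane} {N Φ : ℕ} {σ : State} {p : Plane}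

lemma exec_update (hr : 0 < r) {k : ℕ} {v : ℕ → ℕ} (h : Stores r Q N σ k v) (hfin : Q.Finite)
    (hQ : GeneralPosition r (insert p Q)) (hp : ∀ q ∈ Q, q 0 < p 0) (hr0 : σ.rreg 0 = r)
    (h1 : σ.nreg 1 = 1) (h3 : σ.nreg 3 = N)
    (hN : nodePoint σ N = p) (hnew : newPoint σ = p) (hin : ¬ testInside.holds σ) :
    ∃ ρ t Φ', Exec update σ t ρ ∧ ρ.rreg = σ.rreg ∧ ρ.rarr = σ.rarr ∧ ρ.nreg 2 = σ.nreg 2 ∧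
      ρ.nreg 3 = σ.nreg 3 ∧ t + 2 * roundCost * Φ' ≤ 2 * roundCost * (k + 1) +
        (8 * roundCost + 60) ∧
      ((ρ.nreg 1 = 1 ∧ ∃ k v, Stores r (insert p Q) (N + 1) ρ k v ∧ Φ' = k + 1) ∨
        (ρ.nreg 1 = 0 ∧ ¬ HullExists r (insert p Q) ∧ Φ' = 0)) := by
  obtain ⟨τ, t, hex, hτ, ⟨j, d, hjd, hj, h4, h5, h6, hc, ht⟩ | ⟨h6, hne, ht⟩⟩ :=
    h.exec_findNeighbors hr hfin hQ hp hr0 hN hnew hin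
  · have hτn : ∀ i, i ≠ 4 → i ≠ 5 → i ≠ 6 → τ.nreg i = σ.nreg i := hτ.nreg
    obtain ⟨ρ, t', hex', ht', e1, e2, e3, e4, e5⟩ := exec_link
      ((hτn 3 (by decide) (by decide) (by decide)).trans h3) h4 h5
    refine ⟨ρ, _, d + 2, Exec.seq hex (Exec.iteTrue h6 hex'), e1.trans hτ.rreg,
      e2.trans hτ.rarr, ?_, ?_, ?_, Or.inl ⟨?_, d + 1, _, h.of_link hτ hjd hj e2 e3 e4 e5 hc, rfl⟩⟩
    · rw [e3, Function.update_of_ne (by decide), hτn 2 (by decide) (by decide) (by decide)]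
    · rw [e3, Function.update_of_ne (by decide), hτn 3 (by decide) (by decide) (by decide)]
    · simp only [NExpr.cost, BExpr.cost]; omega
    · rw [e3, Function.update_of_ne (by decide), hτn 1 (by decide) (by decide) (by decide), h1]
  · refine ⟨_, _, 0, Exec.seq hex (Exec.iteFalse h6 (Exec.setNat _ _ _)), hτ.rreg, hτ.rarr, ?_,
      ?_, ?_, Or.inr ⟨by simp [NExpr.eval], hne, rfl⟩⟩
    · simp [hτ.nreg]
    · simp [hτ.nreg]
    · simp only [NExpr.cost, BExpr.cost]; omega

/-- The amortized bound: time plus new potential is at most old potential plus a constant. The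
summand `20` reserves the cost of the surrounding instructions of `insertCmd`. -/
lemma exec_insertCore (hr : 0 < r) (h : Maintained r Q N Φ σ) (hfin : Q.Finite)
    (hQ : GeneralPosition r (insert p Q)) (hp : ∀ q ∈ Q, q 0 < p 0)
    (hN : nodePoint σ N = p) (hnew : newPoint σ = p) :
    ∃ ρ t Φ', Exec insertCore σ t ρ ∧ ρ.rreg = σ.rreg ∧ ρ.rarr = σ.rarr ∧
      ρ.nreg 2 = σ.nreg 2 ∧ ρ.nreg 3 = σ.nreg 3 ∧
      t + 2 * roundCost * Φ' + 20 ≤ 2 * roundCost * Φ + insertCost ∧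
      ((ρ.nreg 1 = 1 ∧ ∃ k v, Stores r (insert p Q) (N + 1) ρ k v ∧ Φ' = k + 1) ∨
        (ρ.nreg 1 = 0 ∧ ¬ HullExists r (insert p Q) ∧ Φ' = 0)) := by
  obtain ⟨hr0, h3, ⟨hN0, hQ0, h1, hΦ⟩ | ⟨hN0, h1, k, v, hs, hΦ⟩ | ⟨hN0, h1, hne, hΦ⟩⟩ := h
  · subst hQ0 hΦ
    refine ⟨_, _, 1, Exec.iteFalse (by simp [BExpr.holds, NExpr.eval, h1])
      (Exec.iteTrue (by simp [BExpr.holds, NExpr.eval, h3, hN0])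
        (Exec.seq (Exec.storeNat _ _ _ _) (Exec.seq (Exec.storeNat _ _ _ _) (Exec.setNat _ _ _)))),
      rfl, rfl, rfl, rfl, ?_,
      Or.inl ⟨by simpa [State.writeNat] using h1, 0, fun _ => N, ?_, rfl⟩⟩
    · simp only [NExpr.cost, BExpr.cost, insertCost]; omega
    · rw [insert_empty_eq]
      refine ⟨HullCycle.singleton hr hN hN, rfl, fun _ => Nat.lt_succ_self N, ?_, fun i _ => ?_,
        fun i _ => ?_⟩
      · simp [State.writeNat, NExpr.eval, h3]
      · simp [State.writeNat, NExpr.eval, h3]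
      · simp [State.writeNat, NExpr.eval, h3]
  · subst hΦ
    have c1 : ¬ (BExpr.natEq (.reg 1) (.const 0)).holds σ := by
      simp [BExpr.holds, NExpr.eval, h1]
    have c2 : ¬ (BExpr.natEq (.reg 3) (.const 0)).holds σ := by
      simp [BExpr.holds, NExpr.eval, h3, hN0]
    by_cases hin : testInside.holds σ
    · refine ⟨σ, _, k + 1, Exec.iteFalse c1 (Exec.iteFalse c2 (Exec.iteTrue hin (Exec.skip _))),
        rfl, rfl, rfl, rfl, ?_, Or.inl ⟨h1, k, v, ?_, rfl⟩⟩
      · simp only [NExpr.cost, BExpr.cost, insertCost]; omega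
      · simp only [testInside, BExpr.holds, holds_inDiskB, NExpr.eval, hr0, hnew, hs.right] at hin
        refine ⟨hs.cycle.insert_of_inDisk hr hQ hp ?_ ?_, hs.closed,
          fun i => (hs.lt i).trans (Nat.lt_succ_self N), hs.right, hs.cw, hs.ccw⟩
        · rw [hs.cw 0 (Nat.zero_le k)] at hin
          exact hin.1
        · rw [hs.ccw_zero, ← hs.closed] at hin
          exact hin.2
    · obtain ⟨ρ, t, Φ', hex, e1, e2, e3, e4, ht, hres⟩ :=
        exec_update hr hs hfin hQ hp hr0 h1 h3 hN hnew hin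
      refine ⟨ρ, _, Φ', Exec.iteFalse c1 (Exec.iteFalse c2 (Exec.iteFalse hin hex)), e1, e2, e3,
        e4, ?_, hres⟩
      simp only [NExpr.cost, BExpr.cost, insertCost]; omega
  · subst hΦ
    refine ⟨σ, _, 0, Exec.iteTrue (by simp [BExpr.holds, NExpr.eval, h1]) (Exec.skip _),
      rfl, rfl, rfl, rfl, ?_, Or.inr ⟨h1, fun ⟨c, hc⟩ => ?_, rfl⟩⟩
    · simp only [NExpr.cost, BExpr.cost, insertCost]; omega
    -- A disk containing the larger set contains `Q`, so nonexistence persists.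
    · exact hne ⟨c, (Set.subset_insert p Q).trans hc⟩

/-- Register `3` is both the counter and the next free address. All stored addresses are below `N`,
so writing the new point there does not disturb the cycle. -/
lemma exec_insert (hr : 0 < r) (h : Maintained r Q N Φ σ) (hfin : Q.Finite)
    (hQ : GeneralPosition r (insert p Q)) (hp : ∀ q ∈ Q, q 0 < p 0) (hnew : newPoint σ = p) :
    ∃ ρ t Φ', Exec insertCmd σ t ρ ∧ Maintained r (insert p Q) (N + 1) Φ' ρ ∧
      t + 2 * roundCost * Φ' ≤ 2 * roundCost * Φ + insertCost ∧ ρ.nreg 2 = σ.nreg 2 ∧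
      nodePoint ρ N = p ∧ ∀ a ≠ N, nodePoint ρ a = nodePoint σ a := by
  have h3 := h.2.1
  set τ := (σ.writeReal 0 N (σ.rreg 1)).writeReal 1 N (σ.rreg 2) with hτ
  have hptN : nodePoint τ N = p := by
    rw [← hnew]; simp [τ, nodePoint, newPoint, State.writeReal]
  have hpt : ∀ a ≠ N, nodePoint τ a = nodePoint σ a := by
    intro a ha
    simp [τ, nodePoint, State.writeReal, Function.update_of_ne ha]
  have hm : Maintained r Q N Φ τ := by
    refine ⟨h.1, h.2.1, h.2.2.imp id (Or.imp ?_ id)⟩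
    rintro ⟨h1, h2, k, v, hs, hΦ⟩
    exact ⟨h1, h2, k, v, hs.congr (fun a ha => hpt a ha.ne) rfl rfl rfl, hΦ⟩
  obtain ⟨ρ, t, Φ', hex, e1, e2, e3, e4, ht, hres⟩ := exec_insertCore hr hm hfin hQ hp hptN hnew
  have s1 : Exec (.storeReal 0 (.reg 3) (.reg 1)) σ 3 (σ.writeReal 0 N (σ.rreg 1)) := by
    have := Exec.storeReal σ 0 (.reg 3) (.reg 1)
    simp only [NExpr.eval, RExpr.eval, h3] at this
    exact this
  have s2 : Exec (.storeReal 1 (.reg 3) (.reg 2)) (σ.writeReal 0 N (σ.rreg 1)) 3 τ := by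
    have := Exec.storeReal (σ.writeReal 0 N (σ.rreg 1)) 1 (.reg 3) (.reg 2)
    have e : (σ.writeReal 0 N (σ.rreg 1)).nreg 3 = N := h3
    simp only [NExpr.eval, RExpr.eval, e] at this
    exact this
  have hpρ : ∀ a, nodePoint { ρ with nreg := Function.update ρ.nreg 3 (ρ.nreg 3 + 1) } a =
      nodePoint τ a := by
    intro a; simp only [nodePoint, e2]
  refine ⟨_, _, Φ', Exec.seq s1 (Exec.seq s2 (Exec.seq hex (Exec.setNat _ _ _))),
    ⟨?_, ?_, Or.inr (hres.imp ?_ ?_)⟩, ?_, ?_, ?_, ?_⟩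
  · show ρ.rreg 0 = r
    rw [e1]; exact h.1
  · simp only [NExpr.eval, Function.update_self, e4]
    exact congrArg (· + 1) h3
  · rintro ⟨h1, k, v, hs, hΦ⟩
    refine ⟨Nat.succ_ne_zero N, by simpa using h1, k, v, hs.congr (fun a _ => rfl) rfl rfl ?_, hΦ⟩
    simp
  · rintro ⟨h1, h2, h3⟩
    exact ⟨Nat.succ_ne_zero N, by simpa using h1, h2, h3⟩
  · simp only [NExpr.cost]; omega
  · simp only
    rw [Function.update_of_ne (by decide), e3]
    rfl
  · exact (hpρ N).trans hptN
  · exact fun a ha => (hpρ a).trans (hpt a ha)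

lemma Maintained.answers (h : Maintained r Q N Φ σ) (hN : N ≠ 0) : Answers r Q σ := by
  obtain ⟨-, -, ⟨hN0, -⟩ | ⟨-, h1, k, v, hs, -⟩ | ⟨-, h1, hne, -⟩⟩ := h
  · exact absurd hN0 hN
  · refine Or.inl ⟨hs.cycle.nonempty, h1, k, fun i => v i, ?_, ?_, by simpa using hs.right, ?_, ?_⟩
    · intro i j hij
      exact Fin.ext (hs.cycle.inj i (by omega) j (by omega) hij)
    · ext q
      rw [hs.cycle.mem_iff]
      constructor
      · rintro ⟨i, rfl⟩
        exact ⟨i, by omega, rfl⟩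
      · rintro ⟨i, hi, rfl⟩
        exact ⟨⟨i, by omega⟩, rfl⟩
    · intro i
      by_cases hi : (i : ℕ) = 0
      · simp [hi]
      · simpa using (hs.cycle.lt i (by omega) hi).le
    · intro i
      have hi : v ((i + 1 : Fin (k + 1)) : ℕ) = v (i + 1) := by
        rw [Fin.val_add_one]
        split_ifs with h
        · rw [h, Fin.val_last, hs.closed]
        · rfl
      refine ⟨?_, ?_, fun hk => ?_⟩
      · simp only [hi]; exact hs.cw i (by omega)
      · simp only [hi]; exact hs.ccw i (by omega)
      · obtain ⟨c, hc⟩ := hs.cycle.arc hk i (by omega)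
        simp only [hi]
        -- Two distinct points at distance `r` from a common center force `r > 0`.
        by_cases hr : 0 < r
        · exact hc.isClockwiseNeighbor hr
        · exfalso
          have h1 := dist_pos.2 hc.ne
          have h2 := dist_triangle_right (nodePoint σ (v i)) (nodePoint σ (v (i + 1))) c
          rw [hc.dist_left, hc.dist_right] at h2
          linarith
  · exact Or.inr ⟨hne, h1⟩

/-! ### The two theorems -/

lemma GeneralPosition.mono {Q' : Set Plane} (h : GeneralPosition r Q) (hQ : Q' ⊆ Q) :
    GeneralPosition r Q' :=
  fun p hp q hq t ht => h p (hQ hp) q (hQ hq) t (hQ ht)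

/-- The first `i` points. -/
def firstPoints {n : ℕ} (p : Fin n → Plane) (i : ℕ) : Set Plane := p '' {j | (j : ℕ) < i}

lemma firstPoints_zero {n : ℕ} (p : Fin n → Plane) : firstPoints p 0 = ∅ := by
  simp [firstPoints]

lemma firstPoints_succ {n : ℕ} (p : Fin n → Plane) (i : Fin n) :
    firstPoints p (i + 1) = insert (p i) (firstPoints p i) := by
  unfold firstPoints
  rw [← Set.image_insert_eq]
  congr 1
  ext j
  simp only [Set.mem_ofPred_eq, Set.mem_insert_iff, Fin.ext_iff]
  omega

lemma firstPoints_finite {n : ℕ} (p : Fin n → Plane) (i : ℕ) : (firstPoints p i).Finite :=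
  (Set.toFinite _).image p

/-- One insertion into a sequence. -/
lemma Admissible.exec_insert (hr : 0 < r) {n : ℕ} {p : Fin n → Plane} (hp : Admissible r p)
    (i : Fin n) (h : Maintained r (firstPoints p i) i Φ σ) (hnew : newPoint σ = p i) :
    ∃ ρ t Φ', Exec insertCmd σ t ρ ∧ Maintained r (firstPoints p (i + 1)) (i + 1) Φ' ρ ∧
      t + 2 * roundCost * Φ' ≤ 2 * roundCost * Φ + insertCost ∧ ρ.nreg 2 = σ.nreg 2 ∧
      nodePoint ρ i = p i ∧ ∀ a ≠ (i : ℕ), nodePoint ρ a = nodePoint σ a := by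
  rw [firstPoints_succ]
  refine CircularHull.exec_insert hr h (firstPoints_finite p i) ?_ ?_ hnew
  · rw [← firstPoints_succ]
    exact hp.2.mono (Set.image_subset_range _ _)
  · rintro q ⟨j, hj, rfl⟩
    exact hp.1 j i hj

def initCmd : Cmd := .seq (.setNat 3 (.const 0)) (.setNat 1 (.const 1))

lemma exec_init (hσ : σ.rreg 0 = r) : ∃ ρ, Exec initCmd σ 4 ρ ∧ Maintained r ∅ 0 0 ρ ∧
    ρ.nreg 2 = σ.nreg 2 ∧ ρ.rarr = σ.rarr := by
  refine ⟨_, Exec.seq (Exec.setNat _ _ _) (Exec.setNat _ _ _), ⟨hσ, ?_, Or.inl ⟨rfl, rfl, ?_, rfl⟩⟩,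
    ?_, rfl⟩
  · simp [NExpr.eval]
  · simp [NExpr.eval]
  · simp

lemma maintainsHull : MaintainsHull initCmd insertCmd (insertCost + 4) := by
  intro r hr n p hp σ₀ hσ₀
  obtain ⟨ρ, hinit, hρ, -, -⟩ := exec_init hσ₀
  -- Stated for every state, with a dummy value where the invariant fails, so that the sequence of
  -- states can be defined by recursion before the invariant is proved.
  have step : ∀ (i : ℕ) (x : State × ℕ), ∃ y : (State × ℕ) × ℕ, ∀ hi : i < n,
      Maintained r (firstPoints p i) i x.2 x.1 →
        Exec insertCmd (withPoint x.1 (p ⟨i, hi⟩)) y.2 y.1.1 ∧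
          Maintained r (firstPoints p (i + 1)) (i + 1) y.1.2 y.1.1 ∧
          y.2 + 2 * roundCost * y.1.2 ≤ 2 * roundCost * x.2 + insertCost := by
    intro i x
    by_cases hx : ∃ hi : i < n, Maintained r (firstPoints p i) i x.2 x.1
    · obtain ⟨hi, hx⟩ := hx
      have hm : Maintained r (firstPoints p i) i x.2 (withPoint x.1 (p ⟨i, hi⟩)) := by
        refine ⟨by simpa [withPoint] using hx.1, hx.2.1, hx.2.2.imp id (Or.imp ?_ id)⟩
        rintro ⟨h1, h2, k, v, hs, hΦ⟩
        exact ⟨h1, h2, k, v, hs.congr (fun a _ => rfl) rfl rfl rfl, hΦ⟩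
      obtain ⟨ρ, t, Φ', h1, h2, h3, -, -, -⟩ := hp.exec_insert hr ⟨i, hi⟩ hm
        (plane_ext (by simp [newPoint, withPoint]) (by simp [newPoint, withPoint]))
      exact ⟨((ρ, Φ'), t), fun _ _ => ⟨h1, h2, h3⟩⟩
    · exact ⟨(x, 0), fun hi h => absurd ⟨hi, h⟩ hx⟩
  choose F hF using step
  set X : ℕ → State × ℕ := fun i => Nat.rec (ρ, 0) (fun i x => (F i x).1) i with hX
  have hXs : ∀ i, X (i + 1) = (F i (X i)).1 := fun i => rfl
  have hinv : ∀ i ≤ n, Maintained r (firstPoints p i) i (X i).2 (X i).1 := by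
    intro i
    induction i with
    | zero => intro _; rw [firstPoints_zero]; exact hρ
    | succ i ih =>
      intro hi
      rw [hXs]
      exact (hF i (X i) hi (ih (by omega))).2.1
  refine ⟨fun i => (X i).1, 4, fun i => (F i (X i)).2, hinit, by omega, fun i => ⟨?_, ?_⟩,
    fun m hm => ?_⟩
  · exact (hF i (X i) i.2 (hinv i i.2.le)).1
  · have := (hinv (i + 1) i.2).answers (Nat.succ_ne_zero _)
    have hs : p '' Set.Iic i = firstPoints p (i + 1) := by
      unfold firstPoints
      congr 1
      ext j
      simp only [Set.mem_Iic, Set.mem_ofPred_eq, Fin.le_def]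
      omega
    rwa [hs]
  -- The potential telescopes from zero.
  · have key : ∀ m ≤ n, ∑ i ∈ Finset.range m, (F i (X i)).2 + 2 * roundCost * (X m).2 ≤
        insertCost * m := by
      intro m
      induction m with
      | zero => intro _; simp [hX]
      | succ m ih =>
        intro hm
        have h1 := ih (by omega)
        have h2 := (hF m (X m) hm (hinv m (by omega))).2.2
        rw [Finset.sum_range_succ, hXs, mul_add, mul_one]
        omega
    have := key m hm
    rw [add_mul]
    beta_reduce
    omega

/-- The input arrays also serve as node storage: inserting point `i` writes its coordinates back to
entry `i`, and later input is untouched. -/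
def staticBody : Cmd :=
  .seq (.setReal 1 (.load 0 (.reg 3))) (.seq (.setReal 2 (.load 1 (.reg 3))) insertCmd)

def staticLoop : Cmd := .loop (.natLt (.reg 3) (.reg 2)) staticBody

lemma exec_staticLoop (hr : 0 < r) {n : ℕ} {p : Fin n → Plane} (hp : Admissible r p) (d : ℕ) :
    ∀ (i Φ : ℕ) (σ : State), i + d = n → Maintained r (firstPoints p i) i Φ σ → σ.nreg 2 = n →
      (∀ j : Fin n, nodePoint σ j = p j) →
      ∃ ρ t Φ', Exec staticLoop σ t ρ ∧ Maintained r (firstPoints p n) n Φ' ρ ∧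
        t ≤ 2 * roundCost * Φ + (insertCost + 20) * d + 4 := by
  induction d with
  | zero =>
    intro i Φ σ hi h h2 hpt
    obtain rfl : i = n := by omega
    refine ⟨σ, _, Φ, Exec.loopFalse ?_, h, ?_⟩
    · simp [BExpr.holds, NExpr.eval, h.2.1, h2]
    · simp [BExpr.cost, NExpr.cost]
  | succ d ih =>
    intro i Φ σ hi h h2 hpt
    have hin : i < n := by omega
    set τ : State :=
      { σ with rreg := Function.update (Function.update σ.rreg 1 (σ.rarr 0 i)) 2 (σ.rarr 1 i) }
      with hτ
    have s1 : Exec (.setReal 1 (.load 0 (.reg 3))) σ 3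
        { σ with rreg := Function.update σ.rreg 1 (σ.rarr 0 i) } := by
      have := Exec.setReal σ 1 (.load 0 (.reg 3))
      simp only [NExpr.eval, RExpr.eval, h.2.1] at this
      exact this
    have s2 : Exec (.setReal 2 (.load 1 (.reg 3)))
        { σ with rreg := Function.update σ.rreg 1 (σ.rarr 0 i) } 3 τ := by
      have := Exec.setReal { σ with rreg := Function.update σ.rreg 1 (σ.rarr 0 i) } 2
        (.load 1 (.reg 3))
      simp only [NExpr.eval, RExpr.eval, h.2.1] at this
      exact this
    have hm : Maintained r (firstPoints p i) i Φ τ := by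
      refine ⟨by simpa [hτ] using h.1, h.2.1, h.2.2.imp id (Or.imp ?_ id)⟩
      rintro ⟨h1, h2, k, v, hs, hΦ⟩
      exact ⟨h1, h2, k, v, hs.congr (fun a _ => rfl) rfl rfl rfl, hΦ⟩
    have hnew : newPoint τ = p ⟨i, hin⟩ := by
      rw [← hpt ⟨i, hin⟩]
      simp [newPoint, nodePoint, hτ]
    obtain ⟨ρ, t, Φ', hex, hρ, ht, hρ2, hρi, hρa⟩ := hp.exec_insert hr ⟨i, hin⟩ hm hnew
    obtain ⟨ρ', t', Φ'', hex', hρ', ht'⟩ := ih (i + 1) Φ' ρ (by omega) hρ (hρ2.trans h2) (by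
      intro j
      by_cases hj : (j : ℕ) = i
      · obtain rfl : j = ⟨i, hin⟩ := Fin.ext hj
        exact hρi
      · rw [hρa _ hj]
        exact hpt j)
    refine ⟨ρ', _, Φ'', Exec.loopTrue ?_ (Exec.seq s1 (Exec.seq s2 hex)) hex', hρ', ?_⟩
    · simp [BExpr.holds, NExpr.eval, h.2.1, h2, hin]
    · simp only [BExpr.cost, NExpr.cost, mul_add, mul_one]
      omega

lemma computesHullOfSorted : ComputesHullOfSorted (.seq initCmd staticLoop) (insertCost + 30) := by
  intro r hr n hn p hp σ₀ hσ₀ hσn hpt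
  obtain ⟨σ, hinit, hσ, hσ2, hσa⟩ := exec_init hσ₀
  rw [← firstPoints_zero p] at hσ
  obtain ⟨ρ, t, Φ', hex, hρ, ht⟩ := exec_staticLoop hr hp n 0 0 σ (by omega) hσ (hσ2.trans hσn)
    (fun j => plane_ext (by simp [nodePoint, hσa, hpt]) (by simp [nodePoint, hσa, hpt]))
  refine ⟨ρ, _, Exec.seq hinit hex, ?_, ?_⟩
  · rw [add_mul] at ht ⊢
    omega
  · have hs : Set.range p = firstPoints p n := by
      unfold firstPoints
      rw [← Set.image_univ]
      congr 1
      ext j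
      simp
    rw [hs]
    exact hρ.answers (by omega)

end CircularHull

theorem mainTheorem7 :
    (∃ (init insert : RealRAM.Cmd) (C : ℕ), CircularHull.MaintainsHull init insert C) ∧
    (∃ (P : RealRAM.Cmd) (C : ℕ), CircularHull.ComputesHullOfSorted P C) :=
  ⟨⟨_, _, _, CircularHull.maintainsHull⟩, ⟨_, _, CircularHull.computesHullOfSorted⟩⟩
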